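/- Let $k_1,\dots,k_{l+1}$ be positive integers, $n_i=k_1+\dots+k_i$ ($n_0=0$), $n=n_{l+1}$, and put $O_i=(n_i,n-n_i)$. **Graph.** Let $\Lambda$ be the ladder diagram of the flag manifold $F(n_1,\dots,n_l,n)$: the union, over $1\le i\le l$, of the rectangles $[0,n_i]\times[0,n-n_i]$, cut into unit squares. Let $D$ be the set of centres of its unit squares (dots), and let $S$ be the set of $l+1$ stars, the $i$-th star being the point $(n_{i-1},n-n_i)+(\frac12,\frac12)$, $1\le i\le l+1$. Let $\Gamma$ be the graph with vertex set $D\cup S$ whose set of edges $E$ consists of the unit segments joining adjacent vertices, oriented to the right or downwards, with head $h(e)$ and tail $t(e)$. For $1\le i\le l$ the roof $\mathcal R_i$ is the set of the $k_i+k_{i+1}$ edges of the oriented path along the upper right boundary of $\Gamma$ from the $i$-th to the $(i+1)$-st star. Let $B$ be the set of boxes (the $4$-cycles of $\Gamma$, which are unit squares); the corner $\mathcal C_b$ of $b\in B$ consists of its left and bottom edges, the opposite corner $\mathcal C_b^-$ of its top and right edges. Set $\delta(e)=h(e)-t(e)\in\mathbf R^D$, where stars are replaced by $0$. **Period.** Let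 $q\in(\mathbf C^*)^l$ and $\tilde q\in(\mathbf C^*)^B$. Let $M_{q,\tilde q}\subset\mathbf C^E$ be defined by the equations $\mathcal F_i:=\prod_{e\in\mathcal R_i}y_e-q_i=0$ $(1\le i\le l)$ and $\mathcal G_b:=\prod_{e\in\mathcal C_b}y_e-\tilde q_b\prod_{e\in\mathcal C_b^-}y_e=0$ $(b\in B)$. Let $\omega=\mathrm{Res}\big(\Omega/(\prod_i\mathcal F_i\prod_b\mathcal G_b)\big)$, $\Omega=\bigwedge_{e\in E}dy_e$, be the residue form on $M_{q,\tilde q}$, that is, the form with $\bigwedge_i d\mathcal F_i\wedge\bigwedge_b d\mathcal G_b\wedge\omega=\Omega$ along $M_{q,\tilde q}$. Let $\sigma\subset\mathbf R^D$ be a cone generated by the vectors $\delta(e)$, $e\in G_\sigma$, where $G_\sigma$ is obtained from $E$ by leaving out one edge $e_i$ of each roof $\mathcal R_i$ and one edge $f_b$ of each corner $\mathcal C_b$. Let $$\gamma=\gamma(\sigma)=\{y\in M_{q,\tilde q} : |y_e|=1\text{ for all } e\in E\text{ with }\delta(e)\in\sigma\}.$$ Then for all $\theta\in\mathbf R^{G_\sigma}$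 there is exactly one point of $M_{q,\tilde q}$ with $y_e=\exp(\sqrt{-1}\,\theta_e)$ for all $e\in G_\sigma$; it depends smoothly on $\theta$, and $\theta\in[0,2\pi)^{G_\sigma}$ parametrizes $\gamma$ bijectively. The residue form $\omega$ exists, and $e^{\sum_e y_e}\,\omega$ is integrable over $\gamma$. Order the edges in $\Omega$ as $(e_i)_i,(f_b)_b$, followed by $G_\sigma$ in some order, orient $\gamma$ by the angles $\theta_e$, $e\in G_\sigma$, in the same order, and put $$I(q,\tilde q)=\frac1{(2\pi \sqrt{-1})^{|D|}}\int_{\gamma}e^{\sum_{e\in E}y_e}\,\omega .$$ **Dual graph.** Let $W$ be the set of edges (sides of unit squares) of $\Lambda$ that intersect $\Gamma$, oriented to the right or upwards. The head $h(w)$ of $w\in W$ is the box in whose centre $w$ ends, or $i$ if $w$ crosses the roof $\mathcal R_i$ and so ends outside the boxes; the tail $t(w)$ is the box in whose centre $w$ starts, or $0$ if there is none. Put $m_0=0$. **Theorem.** For all such $\sigma$, $q$ and $\tilde q$, $$I(q,\tilde q)=\sum_{m}A_m\;\prod_{i=1}^l q_i^{m_i}\prod_{b\in B}\tilde q_b^{\,m_b},\qquad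 A_m=\prod_{i=1}^l\frac1{(m_i!)^{k_i+k_{i+1}}}\ \prod_{w\in W}\binom{m_{h(w)}}{m_{t(w)}},$$ where the sum runs over all families $m=(m_1,\dots,m_l,(m_b)_{b\in B})$ of non-negative integers and converges absolutely. -/

import Mathlib

open scoped Nat ContDiff
open MeasureTheory

namespace PartialFlag

/-! ## The ladder diagram, its graph, roofs, corners and boxes

The flag type is `k = (k₁, …, k_{l+1})`, indexed here by `Fin (l + 1)` starting from `0`.
A unit square of the plane is named by its lower left corner in `ℕ × ℕ`; its centre is the
possible position of a dot or of a star. -/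

/-- The number `n_i = k₁ + ⋯ + k_i`. -/
def flagDim {l : ℕ} (k : Fin (l + 1) → ℕ) (i : ℕ) : ℕ :=
  ∑ j : Fin (l + 1) with j.val < i, k j

/-- The number `n = n_{l+1}`. -/
def total {l : ℕ} (k : Fin (l + 1) → ℕ) : ℕ := flagDim k (l + 1)

/-- The unit squares (dots) of the ladder diagram `Λ`. The common vertex of the `i`-th and
`(i+1)`-st diagonal squares is `O_i = (n_i, n - n_i)`, and `Λ` is the union of the rectangles with
opposite vertices `O_0 = (0, 0)` and `O_i`, `1 ≤ i ≤ l`. -/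
def dots {l : ℕ} (k : Fin (l + 1) → ℕ) : Finset (ℕ × ℕ) :=
  (Finset.range (total k) ×ˢ Finset.range (total k)).filter fun p =>
    ∃ i : Fin l, p.1 < flagDim k (i + 1) ∧ p.2 + flagDim k (i + 1) < total k

/-- The `i`-th star: it sits in the lower left unit square of the `i`-th diagonal square, which is
`[n_{i-1}, n_i] × [n - n_i, n - n_{i-1}]`. -/
def star {l : ℕ} (k : Fin (l + 1) → ℕ) (i : Fin (l + 1)) : ℕ × ℕ :=
  (flagDim k i, total k - flagDim k (i + 1))

/-- The vertices of the graph `Γ`: dots and stars. -/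
def vertices {l : ℕ} (k : Fin (l + 1) → ℕ) : Finset (ℕ × ℕ) :=
  dots k ∪ Finset.univ.image (star k)

/-- The oriented edges `e = (t(e), h(e))` of `Γ`: they join adjacent vertices; the horizontal ones
are oriented to the right and the vertical ones downwards. -/
def edges {l : ℕ} (k : Fin (l + 1) → ℕ) : Finset ((ℕ × ℕ) × (ℕ × ℕ)) :=
  (vertices k ×ˢ vertices k).filter fun e => e.2 = e.1 + (1, 0) ∨ e.1 = e.2 + (0, 1)

/-- The set `E` of edges of `Γ` as a type. -/
abbrev Edge {l : ℕ} (k : Fin (l + 1) → ℕ) : Type := ↥(edges k)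

/-- The boxes: the 4-cycles of `Γ`. As `Γ` is a full subgraph of the square grid, these are the
unit squares all of whose vertices belong to `Γ`; a box is named by its lower left vertex. -/
def boxes {l : ℕ} (k : Fin (l + 1) → ℕ) : Finset (ℕ × ℕ) :=
  (vertices k).filter fun p =>
    p + (1, 0) ∈ vertices k ∧ p + (0, 1) ∈ vertices k ∧ p + (1, 1) ∈ vertices k

/-- The set `B` of boxes as a type. -/
abbrev Box {l : ℕ} (k : Fin (l + 1) → ℕ) : Type := ↥(boxes k)

/-- The corner of a box: the left edge and the bottom edge. -/
def corner {l : ℕ} (k : Fin (l + 1) → ℕ) (b : Box k) : Finset (Edge k) :=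
  Finset.univ.filter fun e =>
    e.1 = (b.1 + (0, 1), b.1) ∨ e.1 = (b.1, b.1 + (1, 0))

/-- The opposite corner of a box: the top edge and the right edge. -/
def oppCorner {l : ℕ} (k : Fin (l + 1) → ℕ) (b : Box k) : Finset (Edge k) :=
  Finset.univ.filter fun e =>
    e.1 = (b.1 + (0, 1), b.1 + (1, 1)) ∨ e.1 = (b.1 + (1, 1), b.1 + (1, 0))

/-- The vertices of the oriented path along the upper right boundary of `Γ` from one star to the
next: from the star one step down, along the top row of dots (height `n - n_i - 1`) to the right
up to the square below and to the left of `O_i`, down along the last column of dots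
(abscissa `n_i - 1`), and one step to the right to the next star. -/
def OnRoof {l : ℕ} (k : Fin (l + 1) → ℕ) (i : Fin l) (p : ℕ × ℕ) : Prop :=
  p = star k i.castSucc ∨
  (p.2 + flagDim k (i + 1) + 1 = total k ∧ flagDim k i ≤ p.1 ∧ p.1 < flagDim k (i + 1)) ∨
  (p.1 + 1 = flagDim k (i + 1) ∧
    total k ≤ p.2 + flagDim k (i + 2) ∧ p.2 + flagDim k (i + 1) < total k) ∨
  p = star k i.succ

instance {l : ℕ} (k : Fin (l + 1) → ℕ) (i : Fin l) : DecidablePred (OnRoof k i) :=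
  fun _ => inferInstanceAs (Decidable (_ ∨ _))

/-- The roof `R_i`: the edges of the path described by `OnRoof`. -/
def roof {l : ℕ} (k : Fin (l + 1) → ℕ) (i : Fin l) : Finset (Edge k) :=
  Finset.univ.filter fun e => OnRoof k i e.1.1 ∧ OnRoof k i e.1.2

/-- The index set of the equations (and of the exponents): one for each roof, one for each box. -/
abbrev Idx {l : ℕ} (k : Fin (l + 1) → ℕ) : Type := Fin l ⊕ Box k

/-! ## The family of complete intersections -/

/-- The defining polynomials: `F_i = ∏_{e ∈ R_i} y_e - q_i` for the roofs and
`G_b = y_e y_f - q̃_b y_g y_h` for the boxes, `{e, f}` the corner, `{g, h}` the opposite corner. -/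
def eqn {l : ℕ} (k : Fin (l + 1) → ℕ) (q : Fin l → ℂ) (qt : Box k → ℂ) :
    Idx k → (Edge k → ℂ) → ℂ
  | .inl i, y => ∏ e ∈ roof k i, y e - q i
  | .inr b, y => ∏ e ∈ corner k b, y e - qt b * ∏ e ∈ oppCorner k b, y e

/-- The affine variety `M_{q, q̃}`. -/
def mirrorVariety {l : ℕ} (k : Fin (l + 1) → ℕ) (q : Fin l → ℂ) (qt : Box k → ℂ) :
    Set (Edge k → ℂ) :=
  {y | ∀ a, eqn k q qt a y = 0}

/-! ## Maximal cones of the refined fan and the torus cycles -/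

/-- `δ(e) = h(e) - t(e)` in `ℝ^D`, the stars being set to zero. -/
def delta {l : ℕ} (k : Fin (l + 1) → ℕ) (e : Edge k) : ↥(dots k) → ℝ := fun d =>
  (if e.1.2 = d.1 then 1 else 0) - (if e.1.1 = d.1 then 1 else 0)

/-- The data defining a cone of maximal dimension of the refined fan: the choice of one edge to be
left out from each roof and from each corner. -/
structure MaxCone {l : ℕ} (k : Fin (l + 1) → ℕ) where
  /-- the edges that are left out -/
  dropped : Idx k → Edge k
  dropped_roof : ∀ i, dropped (.inl i) ∈ roof k i
  dropped_corner : ∀ b, dropped (.inr b) ∈ corner k b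

namespace MaxCone

variable {l : ℕ} {k : Fin (l + 1) → ℕ}

/-- The edges that are not left out. -/
abbrev Gen (σ : MaxCone k) : Type := {e : Edge k // ∀ a, σ.dropped a ≠ e}

/-- The cone in `ℝ^D` generated by the `δ(e)`, `e` not left out. -/
def cone (σ : MaxCone k) : Set (↥(dots k) → ℝ) :=
  {x | ∃ c : σ.Gen → ℝ, (∀ g, 0 ≤ c g) ∧ x = ∑ g, c g • delta k g.1}

/-- The cycle `γ(σ) = {|y_e| = 1 for all e with δ(e) ∈ σ}` in `M_{q, q̃}`. -/
def cycle (σ : MaxCone k) (q : Fin l → ℂ) (qt : Box k → ℂ) : Set (Edge k → ℂ) :=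
  {y | y ∈ mirrorVariety k q qt ∧ ∀ e, delta k e ∈ σ.cone → ‖y e‖ = 1}

/-- `s` is the parametrization by the angles `θ_e = arg y_e` of the generators `e` of `σ`. -/
def IsAngleParam (σ : MaxCone k) (q : Fin l → ℂ) (qt : Box k → ℂ)
    (s : (σ.Gen → ℝ) → Edge k → ℂ) : Prop :=
  ∀ θ, s θ ∈ mirrorVariety k q qt ∧ ∀ g : σ.Gen, s θ g.1 = Complex.exp (θ g * Complex.I)

/-- All edges, enumerated as: the edges left out, then the generators of `σ`. -/
def coord (σ : MaxCone k) : Idx k ⊕ σ.Gen → Edge k := Sum.elim σ.dropped Subtype.val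

/-- The form `Ω = ⋀_{e ∈ E} dy_e`, the edges being ordered by `coord`. -/
noncomputable def volForm (σ : MaxCone k) (w : Idx k ⊕ σ.Gen → Edge k → ℂ) : ℂ :=
  (Matrix.of fun i j => w i (σ.coord j)).det

/-- `η` represents the Poincaré–Leray residue of `Ω / (∏ F_i ∏ G_b)` on `M_{q, q̃}`, that is
`⋀_i dF_i ∧ ⋀_b dG_b ∧ η = Ω` at the points of `M_{q, q̃}`: the equation is evaluated on
arbitrary vectors `ν`, one for each equation, followed by vectors `v` tangent to `M_{q, q̃}`. -/
def IsResidue (σ : MaxCone k) (q : Fin l → ℂ) (qt : Box k → ℂ)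
    (η : (Edge k → ℂ) → (Edge k → ℂ) [⋀^σ.Gen]→ₗ[ℂ] ℂ) : Prop :=
  ∀ y ∈ mirrorVariety k q qt, ∀ (ν : Idx k → Edge k → ℂ) (v : σ.Gen → Edge k → ℂ),
    (∀ a g, fderiv ℂ (eqn k q qt a) y (v g) = 0) →
    (Matrix.of fun a b => fderiv ℂ (eqn k q qt a) y (ν b)).det * η y v =
      σ.volForm (Sum.elim ν v)

/-- The pull-back of `e^{∑ y_e} η` under the parametrization `s`, as a function of the angles. -/
noncomputable def integrand (σ : MaxCone k) (s : (σ.Gen → ℝ) → Edge k → ℂ)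
    (η : (Edge k → ℂ) → (Edge k → ℂ) [⋀^σ.Gen]→ₗ[ℂ] ℂ) (θ : σ.Gen → ℝ) : ℂ :=
  Complex.exp (∑ e, s θ e) * η (s θ) fun g => fderiv ℝ s θ (Pi.single g 1)

/-- The cube `[0, 2π)^{Gen σ}` of angles. -/
def angles (σ : MaxCone k) : Set (σ.Gen → ℝ) :=
  Set.univ.pi fun _ => Set.Ico 0 (2 * Real.pi)

/-- The normalized period `(2πi)^{-|D|} ∫_{γ(σ)} e^{∑ y_e} η`. -/
noncomputable def period (σ : MaxCone k) (s : (σ.Gen → ℝ) → Edge k → ℂ)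
    (η : (Edge k → ℂ) → (Edge k → ℂ) [⋀^σ.Gen]→ₗ[ℂ] ℂ) : ℂ :=
  ((2 * Real.pi * Complex.I) ^ (dots k).card)⁻¹ * ∫ θ in σ.angles, σ.integrand s η θ

end MaxCone

/-! ## The dual graph and the coefficients -/

/-- The oriented edges `w = (start, end)` of the ladder diagram `Λ` (the sides of its unit squares,
given by lattice points): horizontal ones to the right, vertical ones upwards. -/
def ladderEdges {l : ℕ} (k : Fin (l + 1) → ℕ) : Finset ((ℕ × ℕ) × (ℕ × ℕ)) :=
  (dots k).biUnion fun p =>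
    {(p, p + (1, 0)), (p, p + (0, 1)), (p + (0, 1), p + (1, 1)), (p + (1, 0), p + (1, 1))}

/-- The edge `w` of `Λ` crosses the edge `e` of `Γ`: they have the same midpoint, where the
endpoints of `e` are the centres of the unit squares `e.1` and `e.2`. -/
def Crosses {l : ℕ} (k : Fin (l + 1) → ℕ) (w : (ℕ × ℕ) × (ℕ × ℕ)) (e : Edge k) : Prop :=
  w.1 + w.2 = e.1.1 + e.1.2 + (1, 1)

instance {l : ℕ} (k : Fin (l + 1) → ℕ) (w : (ℕ × ℕ) × (ℕ × ℕ)) : DecidablePred (Crosses k w) :=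
  fun _ => inferInstanceAs (Decidable (_ = _))

/-- The set `W` of edges of `Λ` that intersect `Γ`. -/
def dualEdges {l : ℕ} (k : Fin (l + 1) → ℕ) : Finset ((ℕ × ℕ) × (ℕ × ℕ)) :=
  (ladderEdges k).filter fun w => ∃ e : Edge k, Crosses k w e

open Classical in
/-- The box centred at a lattice point, if there is one. -/
noncomputable def boxAt {l : ℕ} (k : Fin (l + 1) → ℕ) (p : ℕ × ℕ) : Option (Box k) :=
  if h : ∃ b : Box k, b.1 + (1, 1) = p then some h.choose else none

/-- The tail of `w`: a box, or the vertex `0` (here `none`) if `w` starts outside `Γ`. -/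
noncomputable def dualTail {l : ℕ} (k : Fin (l + 1) → ℕ) (w : (ℕ × ℕ) × (ℕ × ℕ)) :
    Option (Idx k) :=
  (boxAt k w.1).map Sum.inr

open Classical in
/-- The head of `w`: a box, or `i` if `w` ends outside `Γ` after crossing the roof `R_i`. -/
noncomputable def dualHead {l : ℕ} (k : Fin (l + 1) → ℕ) (w : (ℕ × ℕ) × (ℕ × ℕ)) :
    Option (Idx k) :=
  match boxAt k w.2 with
  | some b => some (.inr b)
  | none => if h : ∃ i : Fin l, ∃ e ∈ roof k i, Crosses k w e then some (.inl h.choose) else none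

/-- The exponents extended to the vertices of the dual graph by `m_0 = 0`. -/
def extend {l : ℕ} {k : Fin (l + 1) → ℕ} (m : Idx k → ℕ) (v : Option (Idx k)) : ℕ := v.elim 0 m

/-- The coefficient
`A_m = ∏_i (m_i!)^{-(k_i + k_{i+1})} ∏_{w ∈ W} binom(m_{h(w)}, m_{t(w)})`. -/
noncomputable def coeffA {l : ℕ} (k : Fin (l + 1) → ℕ) (m : Idx k → ℕ) : ℂ :=
  (∏ i : Fin l, (((m (.inl i))! : ℂ) ^ (k i.castSucc + k i.succ))⁻¹) *
    ∏ w ∈ dualEdges k, ((extend m (dualHead k w)).choose (extend m (dualTail k w)) : ℂ)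

end PartialFlag

/-!
The equations of the mirror family are a triangular system of monomial equations. Every edge `e`
lies in exactly one roof or corner of a box, `head e`, and in at most one opposite corner, `tail e`;
so the equation with index `a` is `∏_{head e = a} y_e = Q_a ∏_{tail e = a} y_e`, with `Q = (q, q̃)`.
The pairs `(tail e, head e)` are the edges of the dual graph, which is acyclic, since `tail e` is
a box on a smaller antidiagonal than `head e` (the roofs count as lying above all boxes). Hence the
equations can be solved from above for the edges `pivot a` that are left out, and all solutions
are monomials `κ_e ∏_g y_g ^ {L e g}` in the other edges
(`TriangularSystem.exists_isMonomialSolution`, `TriangularSystem.eq_of_eqn`). The Jacobian with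
respect to the pivots is triangular with determinant `∏_g y_g`, so the residue is `⋀_g dlog y_g`,
which is `√-1 ^ |D|` times the volume form of the angles
(`TriangularSystem.IsMonomialSolution.residue_angleParam`).

The period is therefore the mean value of `∏_e exp y_e` over the torus of the angles. In the
exponential series `∑_n ∏_e y_e ^ n_e / n_e!` only those `n` survive with `∑_e n_e L e g = 0` for
all `g`. These are the integral combinations of the relations, `n_e = m_{head e} - m_{tail e}` with
`m_none = 0`. Such an `m` is not negative if `n` is not, because from every vertex of the dual graph
the pivots lead down to `none` (`TriangularSystem.exists_of_orthogonal`), and then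
`∏_e κ_e ^ n_e = ∏_a Q_a ^ m_a`. This gives the coefficient `∏_e 1 / (m_{head e} - m_{tail e})!`
(`TriangularSystem.IsMonomialSolution.hasSum_integral`), which is `A_m`: in the product of the
binomial coefficients over the dual edges, the factorial of a box exponent occurs twice in the
numerator and twice in the denominator, that of a roof exponent once for each edge of the roof, in
the numerator (`PartialFlag.coeffA_eq`).

There remains the description of the cycle: an edge `e` that is left out must not have `δ(e)` in
the cone. By Euler's formula (`PartialFlag.card_free`) the differential of potentials on the dots
takes arbitrary values on the edges that are kept, and a suitable potential separates `δ(e)` from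
the cone (`PartialFlag.delta_dropped_not_mem_cone`).
-/

set_option linter.unusedSectionVars false

/-! ### Triangular systems of monomial equations -/

/-- The combinatorics of a triangular system of monomial equations
`∏_{head e = a} y_e = Q_a ∏_{tail e = a} y_e`, one for each `a : I`, in variables `y_e`, `e : E`.
The pair `(tail e, head e)` is an edge of a directed graph on `I` and one further vertex `none`;
the function `rank` certifies that this graph is acyclic. The variable `y_{pivot a}` is the one
for which the equation `a` is to be solved. -/
structure TriangularSystem (E I : Type*) where
  /-- the equation with `y_e` on its left side -/
  head : E → I
  /-- the equation with `y_e` on its right side, if there is one -/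
  tail : E → Option I
  /-- a height function that increases along the edges -/
  rank : I → ℕ
  rank_lt : ∀ e b, tail e = some b → rank b < rank (head e)
  /-- the variable to be eliminated by an equation -/
  pivot : I → E
  head_pivot : ∀ a, head (pivot a) = a

namespace TriangularSystem

variable {E I : Type*} (S : TriangularSystem E I)

/-- The variables that are not eliminated. -/
abbrev Free : Type _ := {e : E // ∀ a, S.pivot a ≠ e}

lemma pivot_injective : Function.Injective S.pivot := fun a b h => by
  rw [← S.head_pivot a, h, S.head_pivot]

lemma eq_pivot_or_free (e : E) : e = S.pivot (S.head e) ∨ ∀ a, S.pivot a ≠ e := by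
  by_cases h : ∀ a, S.pivot a ≠ e
  · exact .inr h
  · push Not at h
    obtain ⟨a, rfl⟩ := h
    rw [S.head_pivot]
    exact .inl rfl

lemma free_of_head {e : E} {a : I} (h : S.head e = a) (h' : S.pivot a ≠ e) :
    ∀ b, S.pivot b ≠ e := by
  rintro b rfl
  rw [S.head_pivot] at h
  exact h' (h ▸ rfl)

/-- Recursion from the bottom of the graph upwards. -/
lemma exists_rec_up {A : Type*} (F : (a : I) → ({b // S.rank b < S.rank a} → A) → A) :
    ∃ P : I → A, ∀ a, P a = F a fun b => P b := by
  have wf : WellFounded fun a b : I => S.rank a < S.rank b := (measure S.rank).wf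
  exact ⟨wf.fix fun a f => F a fun b => f b b.2, fun a => wf.fix_eq _ a⟩

/-- The exponents of the variables `y_e` in the product over `a` of the `m_a`-th powers of the Laurent
monomials `∏_{head e = a} y_e / ∏_{tail e = a} y_e`, which are constant on the solutions. They are
integers, since `m` need not increase along the edges. -/
def exponent (m : I → ℕ) (e : E) : ℤ := m (S.head e) - ((S.tail e).elim 0 m : ℕ)

/-- The powers of the relations are determined from below by the exponents of the pivots. -/
lemma eq_of_exponent_pivot_eq {m m' : I → ℕ}
    (h : ∀ a, S.exponent m (S.pivot a) = S.exponent m' (S.pivot a)) : m = m' := by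
  funext a
  induction hr : S.rank a using Nat.strong_induction_on generalizing a with
  | _ r ih =>
    have h1 := h a
    simp only [exponent, S.head_pivot] at h1
    rcases h2 : S.tail (S.pivot a) with _ | b
    · rw [h2] at h1
      simpa using h1
    · have := S.rank_lt _ _ h2
      rw [S.head_pivot] at this
      rw [h2, Option.elim_some, Option.elim_some, ih _ (by omega) b rfl] at h1
      omega

variable [Fintype E] [DecidableEq E] [Fintype I] [DecidableEq I]

/-- The coordinates are split into the pivots and the free ones. -/
noncomputable def coordEquiv : I ⊕ S.Free ≃ E :=
  Equiv.ofBijective (Sum.elim S.pivot Subtype.val) (by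
    constructor
    · rintro (a | a) (b | b) h
      · exact congrArg _ (S.pivot_injective h)
      · exact absurd h (b.2 a)
      · exact absurd h.symm (a.2 b)
      · exact congrArg _ (Subtype.ext h)
    · intro e
      rcases S.eq_pivot_or_free e with h | h
      · exact ⟨.inl (S.head e), h.symm⟩
      · exact ⟨.inr ⟨e, h⟩, rfl⟩)

@[simp] lemma coordEquiv_inl (a : I) : S.coordEquiv (.inl a) = S.pivot a := rfl

@[simp] lemma coordEquiv_inr (g : S.Free) : S.coordEquiv (.inr g) = g.1 := rfl

@[to_additive]
lemma prod_head_eq {A : Type*} [CommMonoid A] (X : E → A) (a : I) :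
    ∏ e with S.head e = a, X e =
      X (S.pivot a) * ∏ e with S.head e = a ∧ S.pivot a ≠ e, X e := by
  rw [← Finset.mul_prod_erase _ X (a := S.pivot a) (by simp [S.head_pivot])]
  congr 2
  ext e
  simp only [Finset.mem_erase, Finset.mem_filter, Finset.mem_univ, true_and, ne_eq]
  tauto

/-- Induction over the equations from the top of the graph downwards. -/
lemma rank_induction {P : I → Prop}
    (h : ∀ a, (∀ b, S.rank a < S.rank b → P b) → P a) (a : I) : P a := by
  induction hn : (∑ b, S.rank b) - S.rank a using Nat.strong_induction_on generalizing a with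
  | _ n ih =>
    refine h a fun b hb => ih _ ?_ b rfl
    have := Finset.single_le_sum (f := S.rank) (fun _ _ => Nat.zero_le _) (Finset.mem_univ b)
    omega

/-- A multiplicative solution of the homogeneous system that is trivial on the free variables of
rank at least `r` is trivial on all variables of rank at least `r`. -/
@[to_additive /-- An additive solution of the homogeneous system that vanishes on the free
variables of rank at least `r` vanishes on all variables of rank at least `r`. -/]
lemma eq_one_of_homogeneous {A : Type*} [CommGroup A] (X : E → A) (r : ℕ)
    (hX : ∀ a, r ≤ S.rank a →
      ∏ e with S.head e = a, X e = ∏ e with S.tail e = some a, X e)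
    (h1 : ∀ e, (∀ a, S.pivot a ≠ e) → r ≤ S.rank (S.head e) → X e = 1)
    (e : E) (he : r ≤ S.rank (S.head e)) : X e = 1 := by
  suffices H : ∀ a, r ≤ S.rank a → ∀ e, S.head e = a → X e = 1 from H _ he e rfl
  intro a
  induction a using S.rank_induction with
  | h a ih =>
    intro ha e hea
    rcases S.eq_pivot_or_free e with h | h
    · have h2 := hX a ha
      rw [S.prod_head_eq, Finset.prod_eq_one, mul_one, Finset.prod_eq_one] at h2
      · rw [h, hea, h2]
      · intro e' he'
        have := S.rank_lt e' a (by simpa using he')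
        exact ih _ this (by omega) e' rfl
      · intro e' he'
        simp only [Finset.mem_filter, Finset.mem_univ, true_and] at he'
        exact h1 e' (S.free_of_head he'.1 he'.2) (by rw [he'.1]; exact ha)
    · exact h1 e h (hea ▸ ha)

/-- Recursion from the top of the graph downwards. -/
lemma exists_rec_down {A : Type*} (F : (a : I) → ({b // S.rank a < S.rank b} → A) → A) :
    ∃ P : I → A, ∀ a, P a = F a fun b => P b := by
  have wf : WellFounded fun a b : I => S.rank b < S.rank a :=
    ⟨fun a => S.rank_induction (fun a h => ⟨a, h⟩) a⟩
  exact ⟨wf.fix fun a f => F a fun b => f b b.2, fun a => wf.fix_eq _ a⟩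

/-- The additive system with arbitrary right hand side has a solution with prescribed values of the
free variables. -/
lemma exists_solution {A : Type*} [AddCommGroup A] (x : E → A) (c : I → A) :
    ∃ X : E → A, (∀ e, (∀ a, S.pivot a ≠ e) → X e = x e) ∧
      ∀ a, ∑ e with S.head e = a, X e = c a + ∑ e with S.tail e = some a, X e := by
  classical
  obtain ⟨P, hP⟩ := S.exists_rec_down (A := A) fun a f =>
    c a + (∑ e : {e // S.tail e = some a},
      if ∀ b, S.pivot b ≠ e.1 then x e else f ⟨S.head e.1, S.rank_lt _ _ e.2⟩) -
        ∑ e with S.head e = a ∧ S.pivot a ≠ e, x e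
  refine ⟨fun e => if ∀ b, S.pivot b ≠ e then x e else P (S.head e),
    fun e he => if_pos he, fun a => ?_⟩
  have h1 : ∑ e with S.head e = a ∧ S.pivot a ≠ e,
      (if ∀ b, S.pivot b ≠ e then x e else P (S.head e)) =
      ∑ e with S.head e = a ∧ S.pivot a ≠ e, x e := by
    refine Finset.sum_congr rfl fun e he => if_pos ?_
    simp only [Finset.mem_filter, Finset.mem_univ, true_and] at he
    exact S.free_of_head he.1 he.2
  rw [S.sum_head_eq, h1, if_neg (by simp), S.head_pivot, hP a, sub_add_cancel,
    Finset.sum_subtype (p := fun e => S.tail e = some a) _ (by simp)]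

/-! ### The lattice of relations -/

@[to_additive]
lemma prod_pow_head {A : Type*} [CommMonoid A] (X : E → A) (m : I → ℕ) :
    ∏ e, X e ^ m (S.head e) = ∏ a, (∏ e with S.head e = a, X e) ^ m a := by
  rw [← Finset.prod_fiberwise (g := S.head)]
  refine Finset.prod_congr rfl fun a _ => ?_
  rw [← Finset.prod_pow]
  refine Finset.prod_congr rfl fun e he => ?_
  rw [(Finset.mem_filter.1 he).2]

@[to_additive]
lemma prod_pow_tail {A : Type*} [CommMonoid A] (X : E → A) (m : I → ℕ) :
    ∏ e, X e ^ (S.tail e).elim 0 m = ∏ a, (∏ e with S.tail e = some a, X e) ^ m a := by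
  rw [← Finset.prod_fiberwise (g := S.tail), Fintype.prod_option]
  rw [Finset.prod_eq_one, one_mul]
  · refine Finset.prod_congr rfl fun a _ => ?_
    rw [← Finset.prod_pow]
    refine Finset.prod_congr rfl fun e he => ?_
    rw [(Finset.mem_filter.1 he).2, Option.elim_some]
  · intro e he
    rw [(Finset.mem_filter.1 he).2, Option.elim_none, pow_zero]

/-- Exponents `n` that annihilate the integral solutions of the homogeneous system come from
integers at the vertices of the graph. As every vertex is joined by a path of pivots with `none`,
these integers are not negative if the exponents are not. -/
lemma exists_of_orthogonal (L : E → S.Free → ℤ)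
    (hL : ∀ g g' : S.Free, L g.1 g' = if g = g' then 1 else 0)
    (hL' : ∀ g a, ∑ e with S.head e = a, L e g = ∑ e with S.tail e = some a, L e g)
    (n : E → ℕ) (hn : ∀ g, ∑ e, n e * L e g = 0) :
    ∃ m : I → ℕ, ∀ e, n e + (S.tail e).elim 0 m = m (S.head e) := by
  classical
  obtain ⟨m, hm⟩ := S.exists_rec_up (A := ℕ) fun a f =>
    n (S.pivot a) + if h : ∃ b, S.tail (S.pivot a) = some b then
      f ⟨h.choose, by simpa only [S.head_pivot] using S.rank_lt _ _ h.choose_spec⟩ else 0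
  have hm' : ∀ a, m a = n (S.pivot a) + (S.tail (S.pivot a)).elim 0 m := by
    intro a
    rw [hm a]
    by_cases h : ∃ b, S.tail (S.pivot a) = some b
    · simp only [dif_pos h]
      conv_rhs => rw [h.choose_spec, Option.elim_some]
    · rw [dif_neg h, Option.eq_none_iff_forall_ne_some.2 fun b hb => h ⟨b, hb⟩,
        Option.elim_none]
  refine ⟨m, fun e => ?_⟩
  rcases S.eq_pivot_or_free e with h | h
  · rw [h, S.head_pivot, ← hm']
  · have hd : ∀ g, ∑ e, (n e - S.exponent m e) * L e g = 0 := by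
      intro g
      have h1 := S.sum_nsmul_head (fun e => L e g) m
      have h2 := S.sum_nsmul_tail (fun e => L e g) m
      simp only [hL', nsmul_eq_mul] at h1 h2
      simp only [sub_mul, Finset.sum_sub_distrib, hn, exponent]
      rw [h1, h2]
      simp
    have h3 := hd ⟨e, h⟩
    rw [← S.coordEquiv.sum_comp, Fintype.sum_sum_type] at h3
    simp only [coordEquiv_inl, coordEquiv_inr, hL, exponent] at h3
    rw [Finset.sum_eq_zero, zero_add] at h3
    · simp only [mul_ite, mul_one, mul_zero, Finset.sum_ite_eq', Finset.mem_univ, if_true] at h3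
      omega
    · intro a _
      rw [S.head_pivot, hm' a]
      push_cast
      ring

/-! ### The solutions of a triangular system lie in a torus -/

/-- The polynomial `∏_{head e = a} y_e - Q_a ∏_{tail e = a} y_e`. -/
def eqn (Q : I → ℂ) (a : I) (y : E → ℂ) : ℂ :=
  ∏ e with S.head e = a, y e - Q a * ∏ e with S.tail e = some a, y e

variable {S} {Q : I → ℂ}

lemma ne_zero_of_eqn (hQ : ∀ a, Q a ≠ 0) {y : E → ℂ} (hy : ∀ a, S.eqn Q a y = 0) (e : E) :
    y e ≠ 0 := by
  suffices H : ∀ a e, S.head e = a → y e ≠ 0 from H _ e rfl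
  intro a
  induction a using S.rank_induction with
  | h a ih =>
    intro e he
    have h1 : ∏ e with S.head e = a, y e ≠ 0 := by
      rw [sub_eq_zero.1 (hy a)]
      refine mul_ne_zero (hQ a) (Finset.prod_ne_zero_iff.2 fun e' he' => ?_)
      exact ih _ (S.rank_lt e' a (by simpa using he')) e' rfl
    exact Finset.prod_ne_zero_iff.1 h1 e (by simpa using he)

lemma eq_of_eqn (hQ : ∀ a, Q a ≠ 0) {y z : E → ℂ} (hy : ∀ a, S.eqn Q a y = 0)
    (hz : ∀ a, S.eqn Q a z = 0) (h : ∀ g : S.Free, y g.1 = z g.1) : y = z := by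
  have hy0 := ne_zero_of_eqn hQ hy
  have hz0 := ne_zero_of_eqn hQ hz
  funext e
  have key := S.eq_one_of_homogeneous
    (fun e => Units.mk0 (y e) (hy0 e) / Units.mk0 (z e) (hz0 e)) 0 ?_ ?_ e (Nat.zero_le _)
  · exact congrArg Units.val (div_eq_one.1 key)
  · intro a _
    have hy' := sub_eq_zero.1 (hy a)
    have hz' := sub_eq_zero.1 (hz a)
    rw [Finset.prod_div_distrib, Finset.prod_div_distrib, div_eq_div_iff_mul_eq_mul]
    ext
    push_cast
    simp only [Units.val_mk0]
    rw [hy', hz']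
    ring
  · intro e he _
    rw [div_eq_one]
    ext
    exact h ⟨e, he⟩

/-! ### Differentials of the equations and determinants -/

lemma fderiv_eqn (Q : I → ℂ) (a : I) {y : E → ℂ} (hy0 : ∀ e, y e ≠ 0) (hy : S.eqn Q a y = 0)
    (v : E → ℂ) :
    fderiv ℂ (S.eqn Q a) y v = (∏ e with S.head e = a, y e) *
      (∑ e with S.head e = a, v e / y e - ∑ e with S.tail e = some a, v e / y e) := by
  have hp : ∀ s : Finset E, HasFDerivAt (fun y : E → ℂ => ∏ e ∈ s, y e)
      (∑ e ∈ s, (∏ e' ∈ s.erase e, y e') •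
        (ContinuousLinearMap.proj e : (E → ℂ) →L[ℂ] ℂ)) y := fun s =>
    hasFDerivAt_finsetProd
  have hs : ∀ s : Finset E, (∑ e ∈ s, (∏ e' ∈ s.erase e, y e') •
      (ContinuousLinearMap.proj e : (E → ℂ) →L[ℂ] ℂ)) v = (∏ e ∈ s, y e) * ∑ e ∈ s, v e / y e := by
    intro s
    rw [_root_.sum_apply, Finset.mul_sum]
    refine Finset.sum_congr rfl fun e he => ?_
    rw [← Finset.mul_prod_erase s y he, _root_.smul_apply,
      ContinuousLinearMap.proj_apply, smul_eq_mul]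
    field_simp [hy0 e]
  have hf : HasFDerivAt (S.eqn Q a) _ y := (hp _).sub ((hp _).const_mul (Q a))
  rw [hf.fderiv, _root_.sub_apply, _root_.smul_apply, hs, hs,
    smul_eq_mul, ← mul_assoc, ← sub_eq_zero.1 hy]
  ring

/-- The determinant of a matrix that is triangular with respect to a height function. -/
lemma _root_.Matrix.det_of_rank {R : Type*} [CommRing R] (rank : I → ℕ) (M : Matrix I I R)
    (h : ∀ a b, a ≠ b → rank b ≤ rank a → M a b = 0) : M.det = ∏ a, M a a := by
  have hM : M.BlockTriangular rank := fun a b hab =>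
    h a b (by rintro rfl; exact lt_irrefl _ hab) hab.le
  rw [hM.det, ← Finset.prod_fiberwise_of_maps_to (s := Finset.univ) (t := Finset.univ.image rank)
    (g := rank) (fun a _ => Finset.mem_image_of_mem _ (Finset.mem_univ a))]
  refine Finset.prod_congr rfl fun r _ => ?_
  have : M.toSquareBlock rank r = Matrix.diagonal fun a : {a // rank a = r} => M a a := by
    ext a b
    rcases eq_or_ne a b with rfl | hab
    · rw [Matrix.diagonal_apply_eq]; rfl
    · rw [Matrix.diagonal_apply_ne _ hab]
      exact h _ _ (fun h => hab (Subtype.ext h)) (by rw [a.2, b.2])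
  rw [this, Matrix.det_diagonal, Finset.prod_subtype (p := fun a => rank a = r) _ (by simp)]

/-- The Jacobian determinant with respect to the pivots is the product of the free variables. -/
lemma det_fderiv_pivot (hQ : ∀ a, Q a ≠ 0) {y : E → ℂ} (hy : ∀ a, S.eqn Q a y = 0) :
    (Matrix.of fun a b => fderiv ℂ (S.eqn Q a) y (Pi.single (S.pivot b) 1)).det =
      ∏ g : S.Free, y g.1 := by
  have hy0 := ne_zero_of_eqn hQ hy
  have hsum : ∀ (p : E → Prop) [DecidablePred p] (f : E),
      ∑ e with p e, (Pi.single f (1 : ℂ) : E → ℂ) e / y e = if p f then 1 / y f else 0 := by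
    intro p _ f
    rw [Finset.sum_filter, Finset.sum_eq_single f]
    · rw [Pi.single_eq_same]
    · intro e _ he
      simp [he]
    · simp
  have hT : ∀ a b, fderiv ℂ (S.eqn Q a) y (Pi.single (S.pivot b) 1) =
      (∏ e with S.head e = a, y e) * ((if b = a then 1 / y (S.pivot b) else 0) -
        if S.tail (S.pivot b) = some a then 1 / y (S.pivot b) else 0) := by
    intro a b
    rw [fderiv_eqn Q a hy0 (hy a), hsum, hsum, S.head_pivot]
  have htail : ∀ a b, S.tail (S.pivot b) = some a → S.rank a < S.rank b := by
    intro a b h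
    simpa only [S.head_pivot] using S.rank_lt _ _ h
  rw [Matrix.det_of_rank S.rank]
  · have : ∀ a, (Matrix.of fun a b => fderiv ℂ (S.eqn Q a) y (Pi.single (S.pivot b) 1)) a a =
        (∏ e with S.head e = a, y e) * (y (S.pivot a))⁻¹ := by
      intro a
      rw [Matrix.of_apply, hT, if_pos rfl, if_neg fun h => lt_irrefl _ (htail _ _ h)]
      simp
    rw [Finset.prod_congr rfl fun a _ => this a, Finset.prod_mul_distrib, Finset.prod_fiberwise,
      ← S.coordEquiv.prod_comp, Fintype.prod_sum_type]
    simp only [coordEquiv_inl, coordEquiv_inr, Finset.prod_inv_distrib]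
    have : ∏ a, y (S.pivot a) ≠ 0 := Finset.prod_ne_zero_iff.2 fun a _ => hy0 _
    field_simp
  · intro a b hab hr
    rw [Matrix.of_apply, hT, if_neg (Ne.symm hab), if_neg fun h => not_lt.2 hr (htail _ _ h)]
    simp

/-- For vectors `v` in the kernel of functionals `D a`, the minor of `v` on the free coordinates
determines the minor of `ν, v` on all coordinates. -/
lemma det_mul_det_eq (D : I → (E → ℂ) →L[ℂ] ℂ) (ν : I → E → ℂ) (v : S.Free → E → ℂ)
    (hv : ∀ a g, D a (v g) = 0) :
    (Matrix.of fun a b => D a (ν b)).det * (Matrix.of fun g g' : S.Free => v g g'.1).det =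
      (Matrix.of fun a b => D a (Pi.single (S.pivot b) 1)).det *
        (Matrix.of fun i j => (Sum.elim ν v : I ⊕ S.Free → E → ℂ) i
          ((Sum.elim S.pivot Subtype.val : I ⊕ S.Free → E) j)).det := by
  have hD : ∀ a w, D a w = ∑ j, w (S.coordEquiv j) * D a (Pi.single (S.coordEquiv j) 1) := by
    intro a w
    rw [S.coordEquiv.sum_comp fun e => w e * D a (Pi.single e 1)]
    conv_lhs => rw [pi_eq_sum_univ' w]
    simp [map_sum]
  set W : Matrix (I ⊕ S.Free) (I ⊕ S.Free) ℂ := Matrix.of fun i j =>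
    (Sum.elim ν v : I ⊕ S.Free → E → ℂ) i ((Sum.elim S.pivot Subtype.val : I ⊕ S.Free → E) j)
  -- Right multiplication by this matrix replaces the pivot coordinates by the functionals `D a`.
  let R : Matrix (I ⊕ S.Free) (I ⊕ S.Free) ℂ := Matrix.fromBlocks
    (Matrix.of fun b a => D a (Pi.single (S.pivot b) 1)) 0
    (Matrix.of fun g a => D a (Pi.single g.1 1)) 1
  have hWR : W * R = Matrix.fromBlocks (Matrix.of fun b a => D a (ν b))
      (Matrix.of fun b g => ν b g.1) 0 (Matrix.of fun g g' => v g g'.1) := by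
    ext (b | g) (a | g')
    · simp [Matrix.mul_apply, W, R, hD a (ν b)]
    · simp [Matrix.mul_apply, W, R, Matrix.one_apply]
    · have := hv a g
      rw [hD] at this
      simpa [Matrix.mul_apply, W, R] using this
    · simp [Matrix.mul_apply, W, R, Matrix.one_apply]
  have h1 := congrArg Matrix.det hWR
  rw [Matrix.det_mul, Matrix.det_fromBlocks_zero₂₁, Matrix.det_fromBlocks_zero₁₂, Matrix.det_one,
    mul_one] at h1
  have h2 : (Matrix.of fun a b => D a (ν b)).det = (Matrix.of fun b a => D a (ν b)).det :=
    (Matrix.det_transpose _).symm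
  have h3 : (Matrix.of fun a b => D a (Pi.single (S.pivot b) 1)).det =
      (Matrix.of fun b a => D a (Pi.single (S.pivot b) 1)).det :=
    (Matrix.det_transpose _).symm
  rw [h2, h3, ← h1, mul_comm]

variable (S Q) in
/-- `η` represents the residue of `⋀ dy_e / ∏_a eqn_a` on the set of solutions, the coordinates
being ordered as the pivots followed by the free ones. -/
def IsResidue (η : (E → ℂ) → (E → ℂ) [⋀^S.Free]→ₗ[ℂ] ℂ) : Prop :=
  ∀ y, (∀ a, S.eqn Q a y = 0) → ∀ (ν : I → E → ℂ) (v : S.Free → E → ℂ),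
    (∀ a g, fderiv ℂ (S.eqn Q a) y (v g) = 0) →
    (Matrix.of fun a b => fderiv ℂ (S.eqn Q a) y (ν b)).det * η y v =
      (Matrix.of fun i j => (Sum.elim ν v : I ⊕ S.Free → E → ℂ) i
        ((Sum.elim S.pivot Subtype.val : I ⊕ S.Free → E) j)).det

/-- On the solutions the Jacobian determinant with respect to the pivots does not vanish, so that
the residue is a multiple of the exterior product of the other differentials. -/
lemma exists_isResidue (hQ : ∀ a, Q a ≠ 0) : ∃ η, S.IsResidue Q η := by
  refine ⟨fun y => (∏ g : S.Free, y g.1)⁻¹ •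
    Matrix.detRowAlternating.compLinearMap (LinearMap.funLeft ℂ ℂ Subtype.val), ?_⟩
  intro y hy ν v hv
  have h1 := S.det_mul_det_eq (fun a => fderiv ℂ (S.eqn Q a) y) ν v hv
  have h2 : ∏ g : S.Free, y g.1 ≠ 0 :=
    Finset.prod_ne_zero_iff.2 fun g _ => ne_zero_of_eqn hQ hy _
  rw [det_fderiv_pivot hQ hy] at h1
  rw [← inv_mul_eq_iff_eq_mul₀ h2] at h1
  rw [← h1, AlternatingMap.smul_apply, smul_eq_mul, mul_left_comm]
  rfl

/-! ### Parametrization by the angles of the free variables -/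

variable (S Q) in
/-- The monomials `κ_e ∏_g z_g ^ {L e g}` in the free variables solve the system. -/
structure IsMonomialSolution (κ : E → ℂ) (L : E → S.Free → ℤ) : Prop where
  coeff_ne_zero : ∀ e, κ e ≠ 0
  coeff_free : ∀ g : S.Free, κ g.1 = 1
  coeff_eqn : ∀ a, ∏ e with S.head e = a, κ e = Q a * ∏ e with S.tail e = some a, κ e
  exp_free : ∀ g g' : S.Free, L g.1 g' = if g = g' then 1 else 0
  exp_eqn : ∀ g a, ∑ e with S.head e = a, L e g = ∑ e with S.tail e = some a, L e g

variable (S Q) in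
lemma exists_isMonomialSolution (hQ : ∀ a, Q a ≠ 0) : ∃ κ L, S.IsMonomialSolution Q κ L := by
  obtain ⟨lam, h1, h2⟩ := S.exists_solution (A := ℂ) 0 fun a => Complex.log (Q a)
  choose L h3 h4 using fun g : S.Free => S.exists_solution (A := ℤ) (Pi.single g.1 1) 0
  refine ⟨fun e => Complex.exp (lam e), fun e g => L g e, fun e => Complex.exp_ne_zero _,
    fun g => ?_, fun a => ?_, fun g g' => ?_, fun g a => ?_⟩
  · rw [h1 _ g.2, Pi.zero_apply, Complex.exp_zero]
  · rw [← Complex.exp_sum, ← Complex.exp_sum, h2 a, Complex.exp_add, Complex.exp_log (hQ a)]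
  · rw [h3 _ _ g.2, Pi.single_apply]
    simp only [Subtype.ext_iff]
  · simpa using h4 g a

/-- The monomials as functions of the angles of the free variables. -/
noncomputable def angleParam (κ : E → ℂ) (L : E → S.Free → ℤ) (θ : S.Free → ℝ) (e : E) : ℂ :=
  κ e * Complex.exp ((∑ g, L e g * θ g : ℝ) * Complex.I)

variable {κ : E → ℂ} {L : E → S.Free → ℤ}

namespace IsMonomialSolution

variable (h : S.IsMonomialSolution Q κ L)
include h

lemma angleParam_free (θ : S.Free → ℝ) (g : S.Free) :
    angleParam κ L θ g.1 = Complex.exp (θ g * Complex.I) := by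
  simp [angleParam, h.coeff_free, h.exp_free]

lemma eqn_angleParam (θ : S.Free → ℝ) (a : I) : S.eqn Q a (angleParam κ L θ) = 0 := by
  have hL : ∑ e with S.head e = a, ∑ g, (L e g : ℝ) * θ g =
      ∑ e with S.tail e = some a, ∑ g, (L e g : ℝ) * θ g := by
    rw [Finset.sum_comm, Finset.sum_comm (s := Finset.univ.filter fun e => S.tail e = some a)]
    refine Finset.sum_congr rfl fun g _ => ?_
    rw [← Finset.sum_mul, ← Finset.sum_mul]
    exact_mod_cast congrArg (fun z : ℤ => (z : ℝ) * θ g) (h.exp_eqn g a)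
  simp only [eqn, angleParam, Finset.prod_mul_distrib]
  rw [← Complex.exp_sum, ← Complex.exp_sum, ← Finset.sum_mul, ← Finset.sum_mul,
    ← Complex.ofReal_sum, ← Complex.ofReal_sum, hL, h.coeff_eqn]
  ring

end IsMonomialSolution

lemma contDiff_angleParam (κ : E → ℂ) (L : E → S.Free → ℤ) : ContDiff ℝ ∞ (angleParam κ L) := by
  refine contDiff_pi.2 fun e => ?_
  refine contDiff_const.mul (Complex.contDiff_exp.comp ((Complex.ofRealCLM.contDiff.comp ?_).mul
    contDiff_const))
  exact ContDiff.sum fun g _ => contDiff_const.mul (contDiff_apply ℝ ℝ g)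

lemma fderiv_angleParam (κ : E → ℂ) (L : E → S.Free → ℤ) (θ : S.Free → ℝ) (g : S.Free) (e : E) :
    fderiv ℝ (angleParam κ L) θ (Pi.single g 1) e =
      L e g * Complex.I * angleParam κ L θ e := by
  have hd : DifferentiableAt ℝ (angleParam κ L) θ :=
    (contDiff_angleParam κ L).differentiable (by simp) θ
  have h1 : HasFDerivAt (fun θ : S.Free → ℝ => ∑ g, (L e g : ℝ) * θ g)
      (∑ g, (L e g : ℝ) • (ContinuousLinearMap.proj g : (S.Free → ℝ) →L[ℝ] ℝ)) θ :=
    HasFDerivAt.fun_sum fun g _ => (hasFDerivAt_apply g θ).const_mul _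
  have h2 : HasFDerivAt (fun θ => angleParam κ L θ e) _ θ :=
    (((Complex.ofRealCLM.hasFDerivAt.comp θ h1).mul_const Complex.I).cexp).const_mul (κ e)
  have h3 : HasFDerivAt (fun θ => angleParam κ L θ e) _ θ := hasFDerivAt_pi'.1 hd.hasFDerivAt e
  have h4 := congrArg (fun f => f (Pi.single g 1)) (h3.unique h2)
  simp only [ContinuousLinearMap.comp_apply, ContinuousLinearMap.proj_apply] at h4
  rw [h4]
  simp [angleParam, Pi.single_apply]
  ring

/-- The determinant of the minor of the tangent vectors of the angles on the free coordinates. -/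
lemma IsMonomialSolution.det_fderiv_angleParam (h : S.IsMonomialSolution Q κ L)
    (θ : S.Free → ℝ) :
    (Matrix.of fun g g' : S.Free => fderiv ℝ (angleParam κ L) θ (Pi.single g 1) g'.1).det =
      Complex.I ^ Fintype.card S.Free * ∏ g : S.Free, angleParam κ L θ g.1 := by
  have : (Matrix.of fun g g' : S.Free => fderiv ℝ (angleParam κ L) θ (Pi.single g 1) g'.1) =
      Matrix.diagonal fun g : S.Free => Complex.I * angleParam κ L θ g.1 := by
    ext g g'
    rw [Matrix.of_apply, fderiv_angleParam, h.exp_free]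
    rcases eq_or_ne g g' with rfl | hne
    · simp
    · simp [hne, hne.symm]
  rw [this, Matrix.det_diagonal, Finset.prod_mul_distrib, Finset.prod_const, Finset.card_univ]

lemma IsMonomialSolution.fderiv_eqn_fderiv_angleParam (hQ : ∀ a, Q a ≠ 0)
    (h : S.IsMonomialSolution Q κ L) (θ : S.Free → ℝ) (a : I) (g : S.Free) :
    fderiv ℂ (S.eqn Q a) (angleParam κ L θ)
      (fderiv ℝ (angleParam κ L) θ (Pi.single g 1)) = 0 := by
  have hy := h.eqn_angleParam θ
  have hy0 := ne_zero_of_eqn hQ hy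
  rw [fderiv_eqn Q a hy0 (hy a)]
  simp only [fderiv_angleParam, mul_div_cancel_right₀ _ (hy0 _)]
  rw [← Finset.sum_mul, ← Finset.sum_mul, ← sub_mul]
  rw [sub_eq_zero.2 (by exact_mod_cast congrArg (fun z : ℤ => (z : ℂ)) (h.exp_eqn g a))]
  simp

/-- In the angles the residue is a constant multiple of `⋀ dθ_g`. -/
lemma IsMonomialSolution.residue_angleParam (hQ : ∀ a, Q a ≠ 0) (h : S.IsMonomialSolution Q κ L)
    {η : (E → ℂ) → (E → ℂ) [⋀^S.Free]→ₗ[ℂ] ℂ} (hη : S.IsResidue Q η) (θ : S.Free → ℝ) :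
    η (angleParam κ L θ) (fun g => fderiv ℝ (angleParam κ L) θ (Pi.single g 1)) =
      Complex.I ^ Fintype.card S.Free := by
  have hy := h.eqn_angleParam θ
  have hv := fun a g => h.fderiv_eqn_fderiv_angleParam hQ θ a g
  have h1 := hη _ hy (fun b => Pi.single (S.pivot b) 1) _ hv
  have h2 := S.det_mul_det_eq (fun a => fderiv ℂ (S.eqn Q a) (angleParam κ L θ))
    (fun b => Pi.single (S.pivot b) 1) _ hv
  have h3 : ∏ g : S.Free, angleParam κ L θ g.1 ≠ 0 :=
    Finset.prod_ne_zero_iff.2 fun g _ => ne_zero_of_eqn hQ hy _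
  rw [← h1, h.det_fderiv_angleParam, det_fderiv_pivot hQ hy] at h2
  have h4 := mul_left_cancel₀ h3 h2
  rw [mul_comm] at h4
  exact (mul_left_cancel₀ h3 h4).symm

end TriangularSystem

/-! ### Integration of the exponential series over a torus -/

/-- The product of finitely many absolutely convergent series. -/
lemma hasSum_fintype_prod {ι β : Type*} [Fintype ι] (f : ι → β → ℂ)
    (hf : ∀ i, Summable fun b => ‖f i b‖) :
    (Summable fun x : ι → β => ‖∏ i, f i (x i)‖) ∧
      HasSum (fun x : ι → β => ∏ i, f i (x i)) (∏ i, ∑' b, f i b) := by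
  suffices H : ∀ (n : ℕ) (f : Fin n → β → ℂ), (∀ i, Summable fun b => ‖f i b‖) →
      (Summable fun x : Fin n → β => ‖∏ i, f i (x i)‖) ∧
        HasSum (fun x : Fin n → β => ∏ i, f i (x i)) (∏ i, ∑' b, f i b) by
    let e := Fintype.equivFin ι
    have h1 := H _ (fun i => f (e.symm i)) fun i => hf _
    rw [e.symm.prod_comp fun i => ∑' b, f i b] at h1
    have h2 : ∀ x : ι → β, ∏ i, f (e.symm i) ((e.arrowCongr (Equiv.refl β)) x i) =
        ∏ i, f i (x i) := fun x => e.symm.prod_comp fun i => f i (x i)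
    have h3 := (Equiv.summable_iff (e.arrowCongr (Equiv.refl β))).2 h1.1
    have h4 := (Equiv.hasSum_iff (e.arrowCongr (Equiv.refl β))).2 h1.2
    simp only [Function.comp_def, h2] at h3 h4
    exact ⟨h3, h4⟩
  intro n
  induction n with
  | zero =>
    intro f _
    refine ⟨(hasSum_fintype _).summable, ?_⟩
    convert! hasSum_fintype (fun x : Fin 0 → β => ∏ i, f i (x i)) using 1
    simp
  | succ n ih =>
    intro f hf
    obtain ⟨h1, h2⟩ := ih (fun i => f i.succ) fun i => hf _
    have h3 := (hf 0).mul_norm h1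
    have h4 := (hf 0).of_norm.hasSum.mul h2 h3.of_norm
    let c : β × (Fin n → β) ≃ (Fin (n + 1) → β) := Fin.consEquiv fun _ => β
    have h5 : ∀ p : β × (Fin n → β), ∏ i, f i (c p i) = f 0 p.1 * ∏ i, f i.succ (p.2 i) := by
      intro p
      rw [Fin.prod_univ_succ]
      rfl
    rw [← c.summable_iff, ← c.hasSum_iff, Fin.prod_univ_succ]
    simp only [Function.comp_def, h5]
    exact ⟨h3, h4⟩

lemma hasSum_exp_fintype {ι : Type*} [Fintype ι] (y : ι → ℂ) :
    (Summable fun n : ι → ℕ => ‖∏ i, y i ^ n i / ((n i)! : ℂ)‖) ∧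
      HasSum (fun n : ι → ℕ => ∏ i, y i ^ n i / ((n i)! : ℂ)) (Complex.exp (∑ i, y i)) := by
  have h := hasSum_fintype_prod (fun i (n : ℕ) => y i ^ n / (n ! : ℂ))
    fun i => NormedSpace.norm_expSeries_div_summable (y i)
  refine ⟨h.1, ?_⟩
  rw [Complex.exp_sum]
  convert! h.2 using 2
  rw [Complex.exp_eq_exp_ℂ, NormedSpace.exp_eq_tsum_div]

lemma integral_exp_int (n : ℤ) :
    ∫ t in Set.Ico 0 (2 * Real.pi), Complex.exp ((n * t : ℝ) * Complex.I) =
      if n = 0 then (2 * Real.pi : ℂ) else 0 := by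
  rw [integral_Ico_eq_integral_Ioc, ← intervalIntegral.integral_of_le (by positivity)]
  rcases eq_or_ne n 0 with rfl | hn
  · simp
  · rw [if_neg hn]
    have hc : (n : ℂ) * Complex.I ≠ 0 :=
      mul_ne_zero (Int.cast_ne_zero.2 hn) Complex.I_ne_zero
    have := integral_exp_mul_complex (a := 0) (b := 2 * Real.pi) hc
    rw [show (n : ℂ) * Complex.I * ((2 * Real.pi : ℝ) : ℂ) = n * (2 * Real.pi * Complex.I) by
      push_cast; ring, Complex.exp_int_mul_two_pi_mul_I] at this
    simp only [Complex.ofReal_zero, mul_zero, Complex.exp_zero, sub_self, zero_div] at this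
    rw [← this]
    congr 1 with t
    push_cast
    ring_nf

/-- The orthogonality of the characters of a torus. -/
lemma integral_exp_int_fintype {ι : Type*} [Fintype ι] (n : ι → ℤ) [Decidable (∀ i, n i = 0)] :
    ∫ θ in (Set.univ.pi fun _ : ι => Set.Ico 0 (2 * Real.pi)),
        Complex.exp ((∑ i, n i * θ i : ℝ) * Complex.I) =
      if ∀ i, n i = 0 then (2 * Real.pi : ℂ) ^ Fintype.card ι else 0 := by
  have h : ∀ θ : ι → ℝ, Complex.exp ((∑ i, n i * θ i : ℝ) * Complex.I) =
      ∏ i, Complex.exp ((n i * θ i : ℝ) * Complex.I) := by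
    intro θ
    rw [← Complex.exp_sum, ← Finset.sum_mul, Complex.ofReal_sum]
  rw [volume_pi, Measure.restrict_pi_pi]
  simp only [h]
  rw [integral_fintype_prod_eq_prod fun i t => Complex.exp ((n i * t : ℝ) * Complex.I)]
  simp only [integral_exp_int]
  split_ifs with h0
  · simp [h0]
  · push Not at h0
    obtain ⟨i, hi⟩ := h0
    exact Finset.prod_eq_zero (Finset.mem_univ i) (if_neg hi)

namespace TriangularSystem

variable {E I : Type*} (S : TriangularSystem E I)
variable [Fintype E] [DecidableEq E] [Fintype I] [DecidableEq I]

open Classical in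
/-- The coefficient `∏_e 1 / (m_{head e} - m_{tail e})!`, where `m_none = 0` and where `1 / n!` is
zero for negative `n`. -/
noncomputable def coeff (m : I → ℕ) : ℂ :=
  if ∀ e, (S.tail e).elim 0 m ≤ m (S.head e) then
    ∏ e, (((m (S.head e) - (S.tail e).elim 0 m)! : ℕ) : ℂ)⁻¹ else 0

variable {S} {Q : I → ℂ} {κ : E → ℂ} {L : E → S.Free → ℤ}

lemma continuous_angleParam (κ : E → ℂ) (L : E → S.Free → ℤ) : Continuous (angleParam κ L) :=
  (contDiff_angleParam κ L).continuous

lemma IsMonomialSolution.prod_coeff_pow (h : S.IsMonomialSolution Q κ L) {m : I → ℕ} {n : E → ℕ}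
    (hm : ∀ e, n e + (S.tail e).elim 0 m = m (S.head e)) :
    ∏ e, κ e ^ n e = ∏ a, Q a ^ m a := by
  have h1 := S.prod_pow_head κ m
  simp only [← hm, pow_add, h.coeff_eqn, mul_pow, Finset.prod_mul_distrib] at h1
  rw [S.prod_pow_tail] at h1
  refine mul_right_cancel₀ ?_ h1
  exact Finset.prod_ne_zero_iff.2 fun a _ => pow_ne_zero _
    (Finset.prod_ne_zero_iff.2 fun e _ => h.coeff_ne_zero e)

/-- Exponents at the edges that come from numbers at the vertices are orthogonal to the integral
solutions of the homogeneous system. -/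
lemma IsMonomialSolution.sum_mul_exp_eq_zero (h : S.IsMonomialSolution Q κ L) {m : I → ℕ}
    {n : E → ℕ} (hm : ∀ e, n e + (S.tail e).elim 0 m = m (S.head e)) (g : S.Free) :
    ∑ e, n e * L e g = 0 := by
  have h1 := S.sum_nsmul_head (fun e => L e g) m
  have h2 := S.sum_nsmul_tail (fun e => L e g) m
  simp only [← hm, h.exp_eqn, add_smul, Finset.sum_add_distrib] at h1
  rw [h2] at h1
  simpa using h1

/-- The integral of the exponential of the sum of the coordinates over the torus of the angles:
only those monomials of the exponential series contribute that are constant on the solution set. -/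
theorem IsMonomialSolution.hasSum_integral (h : S.IsMonomialSolution Q κ L) :
    HasSum (fun m : I → ℕ => S.coeff m * ∏ a, Q a ^ m a)
      (((2 * Real.pi : ℂ) ^ Fintype.card S.Free)⁻¹ *
        ∫ θ in (Set.univ.pi fun _ : S.Free => Set.Ico 0 (2 * Real.pi)),
          Complex.exp (∑ e, angleParam κ L θ e)) := by
  classical
  have hpi : (2 * Real.pi : ℂ) ^ Fintype.card S.Free ≠ 0 :=
    pow_ne_zero _ (mul_ne_zero two_ne_zero (Complex.ofReal_ne_zero.2 Real.pi_ne_zero))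
  have hvol : IsFiniteMeasure (volume.restrict
      (Set.univ.pi fun _ : S.Free => Set.Ico 0 (2 * Real.pi))) := by
    rw [volume_pi, Measure.restrict_pi_pi]
    infer_instance
  set μ := volume.restrict (Set.univ.pi fun _ : S.Free => Set.Ico 0 (2 * Real.pi)) with hμ
  let F : (E → ℕ) → (S.Free → ℝ) → ℂ := fun n θ =>
    ∏ e, angleParam κ L θ e ^ n e / ((n e)! : ℂ)
  have hF : ∀ n θ, F n θ = (∏ e, κ e ^ n e / ((n e)! : ℂ)) *
      Complex.exp ((∑ g, (∑ e, n e * L e g : ℤ) * θ g : ℝ) * Complex.I) := by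
    intro n θ
    have : ((∑ g, (∑ e, n e * L e g : ℤ) * θ g : ℝ) * Complex.I : ℂ) =
        ∑ e, n e * ((∑ g, L e g * θ g : ℝ) * Complex.I) := by
      push_cast
      simp only [Finset.sum_mul, Finset.mul_sum]
      rw [Finset.sum_comm]
      refine Finset.sum_congr rfl fun e _ => Finset.sum_congr rfl fun g _ => ?_
      ring
    rw [this, Complex.exp_sum, ← Finset.prod_mul_distrib]
    refine Finset.prod_congr rfl fun e _ => ?_
    rw [angleParam, mul_pow, Complex.exp_nat_mul]
    ring
  have hnorm : ∀ n θ, ‖F n θ‖ = ‖∏ e, κ e ^ n e / ((n e)! : ℂ)‖ := by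
    intro n θ
    rw [hF, norm_mul, Complex.norm_exp_ofReal_mul_I, mul_one]
  have hint : ∀ n, ∫ θ, F n θ ∂μ = (2 * Real.pi) ^ Fintype.card S.Free *
      if ∀ g, ∑ e, (n e : ℤ) * L e g = 0 then ∏ e, κ e ^ n e / ((n e)! : ℂ) else 0 := by
    intro n
    simp only [hF]
    rw [integral_const_mul, hμ, integral_exp_int_fintype]
    split_ifs <;> ring
  have hFi : ∀ n, Integrable (F n) μ := by
    intro n
    refine Integrable.of_bound (C := ‖∏ e, κ e ^ n e / ((n e)! : ℂ)‖) ?_ ?_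
    · refine Continuous.aestronglyMeasurable ?_
      refine continuous_finsetProd _ fun e _ => ?_
      exact ((continuous_apply e |>.comp (continuous_angleParam κ L)).pow _).div_const _
    · exact Filter.Eventually.of_forall fun θ => (hnorm n θ).le
  have hsum : Summable fun n => ∫ θ, ‖F n θ‖ ∂μ := by
    simp only [hnorm, integral_const, smul_eq_mul]
    exact (hasSum_exp_fintype κ).1.mul_left _
  have key := (hasSum_integral_of_summable_integral_norm hFi hsum).mul_left
    ((2 * Real.pi : ℂ) ^ Fintype.card S.Free)⁻¹
  have htsum : ∀ θ, ∑' n, F n θ = Complex.exp (∑ e, angleParam κ L θ e) := fun θ =>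
    (hasSum_exp_fintype _).2.tsum_eq
  simp only [htsum, hint, inv_mul_cancel_left₀ hpi] at key
  -- The exponents that contribute are indexed by the `m` that increase along the edges.
  let T : Set (I → ℕ) := {m | ∀ e, (S.tail e).elim 0 m ≤ m (S.head e)}
  let d : T → E → ℕ := fun m e => m.1 (S.head e) - (S.tail e).elim 0 m.1
  have hd : ∀ (m : T) e, d m e + (S.tail e).elim 0 m.1 = m.1 (S.head e) := fun m e =>
    Nat.sub_add_cancel (m.2 e)
  have hinj : Function.Injective d := by
    intro m m' hmm
    refine Subtype.ext (S.eq_of_exponent_pivot_eq fun a => ?_)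
    have h1 := hd m (S.pivot a)
    have h2 := hd m' (S.pivot a)
    rw [hmm] at h1
    simp only [exponent]
    omega
  have hrange : ∀ n ∉ Set.range d, (if ∀ g, ∑ e, (n e : ℤ) * L e g = 0 then
      ∏ e, κ e ^ n e / ((n e)! : ℂ) else 0) = 0 := by
    intro n hn
    refine if_neg fun h0 => hn ?_
    obtain ⟨m, hm⟩ := S.exists_of_orthogonal L h.exp_free h.exp_eqn n h0
    refine ⟨⟨m, fun e => by rw [← hm e]; exact Nat.le_add_left _ _⟩, ?_⟩
    funext e
    exact (Nat.eq_sub_of_add_eq (hm e)).symm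
  rw [← hinj.hasSum_iff hrange] at key
  rw [← hasSum_subtype_iff_of_support_subset (s := T)]
  · convert! key using 1
    funext m
    have h1 : ∀ e, (S.tail e).elim 0 m.1 ≤ m.1 (S.head e) := m.2
    simp only [Function.comp_apply, coeff]
    rw [if_pos h1, if_pos (h.sum_mul_exp_eq_zero (hd m)), Finset.prod_div_distrib,
      h.prod_coeff_pow (hd m), Finset.prod_inv_distrib, div_eq_mul_inv, mul_comm]
  · intro m hm
    by_contra h0
    have h1 : ¬ ∀ e, (S.tail e).elim 0 m ≤ m (S.head e) := h0
    exact hm (by simp only [coeff]; rw [if_neg h1, zero_mul])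

end TriangularSystem

namespace PartialFlag

variable {l : ℕ} {k : Fin (l + 1) → ℕ}

/-! ### Vertices, boxes and roofs of the ladder graph -/

lemma flagDim_zero : flagDim k 0 = 0 := by simp [flagDim]

lemma flagDim_succ (j : Fin (l + 1)) : flagDim k (j + 1) = flagDim k j + k j := by
  have : Finset.univ.filter (fun i : Fin (l + 1) => i.val < j + 1) =
      insert j (Finset.univ.filter fun i : Fin (l + 1) => i.val < j) := by
    ext i
    simp only [Finset.mem_filter, Finset.mem_univ, true_and, Finset.mem_insert, Fin.ext_iff]
    omega
  rw [flagDim, this, Finset.sum_insert (by simp), add_comm]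
  rfl

lemma flagDim_mono {i j : ℕ} (h : i ≤ j) : flagDim k i ≤ flagDim k j := by
  refine Finset.sum_le_sum_of_subset fun a ha => ?_
  simp only [Finset.mem_filter, Finset.mem_univ, true_and] at ha ⊢
  omega

lemma flagDim_lt (hk : ∀ j, 0 < k j) {i j : ℕ} (h : i < j) (hi : i ≤ l) :
    flagDim k i < flagDim k j := by
  have h1 := flagDim_succ (k := k) ⟨i, by omega⟩
  have h2 := hk ⟨i, by omega⟩
  have h3 := flagDim_mono (k := k) (Nat.succ_le_of_lt h)
  simp only [Nat.succ_eq_add_one] at h1 h3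
  omega

lemma flagDim_le_total {i : ℕ} (h : i ≤ l + 1) : flagDim k i ≤ total k := flagDim_mono h

lemma mem_dots {x y : ℕ} :
    (x, y) ∈ dots k ↔ ∃ i < l, x < flagDim k (i + 1) ∧ y + flagDim k (i + 1) < total k := by
  simp only [dots, Finset.mem_filter, Finset.mem_product, Finset.mem_range]
  constructor
  · rintro ⟨_, i, h⟩
    exact ⟨i, i.2, h⟩
  · rintro ⟨i, hi, h1, h2⟩
    have := flagDim_le_total (k := k) (i := i + 1) (by omega)
    exact ⟨⟨by omega, by omega⟩, ⟨i, hi⟩, h1, h2⟩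

lemma mem_vertices {x y : ℕ} : (x, y) ∈ vertices k ↔ (x, y) ∈ dots k ∨
    ∃ j ≤ l, x = flagDim k j ∧ y + flagDim k (j + 1) = total k := by
  simp only [vertices, Finset.mem_union, Finset.mem_image, Finset.mem_univ, true_and]
  refine or_congr_right ⟨?_, ?_⟩
  · rintro ⟨j, hj⟩
    have := flagDim_le_total (k := k) (i := j + 1) (by omega)
    simp only [star, Prod.mk.injEq] at hj
    exact ⟨j, by omega, hj.1.symm, by omega⟩
  · rintro ⟨j, hj, h1, h2⟩
    refine ⟨⟨j, by omega⟩, ?_⟩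
    simp only [star, Prod.mk.injEq]
    exact ⟨h1.symm, by omega⟩

lemma star_not_mem_dots {x y j : ℕ} (hx : x = flagDim k j)
    (hy : y + flagDim k (j + 1) = total k) : (x, y) ∉ dots k := by
  rw [mem_dots]
  rintro ⟨i, hi, h1, h2⟩
  rcases le_or_gt j i with h | h
  · have := flagDim_mono (k := k) (show j + 1 ≤ i + 1 by omega)
    omega
  · have := flagDim_mono (k := k) (show i + 1 ≤ j by omega)
    omega

lemma mem_dots_of_right (hk : ∀ j, 0 < k j) {x y : ℕ} (h : (x + 1, y) ∈ vertices k) :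
    (x, y) ∈ dots k := by
  rw [mem_vertices] at h
  rw [mem_dots]
  rcases h with h | ⟨j, hj, h1, h2⟩
  · obtain ⟨i, hi, h1, h2⟩ := mem_dots.1 h
    exact ⟨i, hi, by omega, h2⟩
  · have := flagDim_lt hk (show j < j + 1 by omega) hj
    rcases j with _ | j
    · rw [flagDim_zero] at h1
      omega
    · exact ⟨j, by omega, by omega, by omega⟩

lemma mem_dots_of_up (hk : ∀ j, 0 < k j) {x y : ℕ} (h : (x, y + 1) ∈ vertices k) :
    (x, y) ∈ dots k := by
  rw [mem_vertices] at h
  rw [mem_dots]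
  rcases h with h | ⟨j, hj, h1, h2⟩
  · obtain ⟨i, hi, h1, h2⟩ := mem_dots.1 h
    exact ⟨i, hi, h1, by omega⟩
  · have := flagDim_lt hk (show j < j + 1 by omega) hj
    refine ⟨j, ?_, by omega, by omega⟩
    by_contra h3
    obtain rfl : j = l := by omega
    simp only [total] at h2
    omega

lemma dots_subset_vertices : dots k ⊆ vertices k := Finset.subset_union_left

lemma mem_boxes (hk : ∀ j, 0 < k j) {x y : ℕ} :
    (x, y) ∈ boxes k ↔ (x + 1, y + 1) ∈ vertices k := by
  simp only [boxes, Finset.mem_filter, Prod.mk_add_mk, add_zero]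
  refine ⟨fun h => h.2.2.2, fun h => ?_⟩
  have h1 := dots_subset_vertices (mem_dots_of_right hk h)
  have h2 := dots_subset_vertices (mem_dots_of_up hk h)
  exact ⟨dots_subset_vertices (mem_dots_of_right hk h2), h2, h1, h⟩

lemma box_mem_dots (hk : ∀ j, 0 < k j) {x y : ℕ} (h : (x, y) ∈ boxes k) : (x, y) ∈ dots k :=
  mem_dots_of_right hk (dots_subset_vertices (mem_dots_of_up hk ((mem_boxes hk).1 h)))

variable (k) in
/-- The interior vertices of a roof: its top row and its right column. -/
def RoofDot (i : ℕ) (p : ℕ × ℕ) : Prop :=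
  (p.2 + flagDim k (i + 1) + 1 = total k ∧ flagDim k i ≤ p.1 ∧ p.1 < flagDim k (i + 1)) ∨
  (p.1 + 1 = flagDim k (i + 1) ∧
    total k ≤ p.2 + flagDim k (i + 2) ∧ p.2 + flagDim k (i + 1) < total k)

lemma RoofDot.mem_dots {i : ℕ} (hi : i < l) {x y : ℕ} (h : RoofDot k i (x, y)) :
    (x, y) ∈ dots k := by
  rw [PartialFlag.mem_dots]
  simp only [RoofDot] at h
  exact ⟨i, hi, by omega, by omega⟩

lemma RoofDot.eq (hk : ∀ j, 0 < k j) {i j : ℕ} (hi : i < l) (hj : j < l) {p : ℕ × ℕ}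
    (h : RoofDot k i p) (h' : RoofDot k j p) : i = j := by
  have h1 := flagDim_lt hk (show i < i + 1 by omega) hi.le
  have h2 := flagDim_lt hk (show j < j + 1 by omega) hj.le
  simp only [RoofDot] at h h'
  rcases lt_trichotomy i j with h3 | h3 | h3
  · have := flagDim_mono (k := k) (show i + 1 ≤ j by omega)
    omega
  · exact h3
  · have := flagDim_mono (k := k) (show j + 1 ≤ i by omega)
    omega

lemma RoofDot.not_mem_boxes (hk : ∀ j, 0 < k j) {i : ℕ} (hi : i < l) {x y : ℕ}
    (h : RoofDot k i (x, y)) : (x, y) ∉ boxes k := by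
  rw [mem_boxes hk, mem_vertices, PartialFlag.mem_dots]
  simp only [RoofDot] at h
  have h0 := flagDim_lt hk (show i < i + 1 by omega) hi.le
  have h0' := flagDim_lt hk (show i + 1 < i + 2 by omega) (by omega)
  rintro (⟨j, hj, h1, h2⟩ | ⟨j, hj, h1, h2⟩)
  · rcases lt_trichotomy j i with h3 | rfl | h3
    · have := flagDim_mono (k := k) (show j + 1 ≤ i by omega)
      omega
    · omega
    · have := flagDim_mono (k := k) (show i + 2 ≤ j + 1 by omega)
      omega
  · have h4 := flagDim_lt hk (show j < j + 1 by omega) hj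
    rcases lt_trichotomy j i with h3 | rfl | h3
    · have := flagDim_mono (k := k) (show j + 1 ≤ i by omega)
      omega
    · omega
    · have := flagDim_mono (k := k) (show i + 1 ≤ j by omega)
      have := flagDim_mono (k := k) (show i + 2 ≤ j + 1 by omega)
      rcases h with h | h
      · omega
      · rcases eq_or_ne j (i + 1) with rfl | h5
        · omega
        · have := flagDim_lt hk (show i + 1 < j by omega) (by omega)
          omega

/-- Every dot is the lower left vertex of a box or lies on a roof. -/
lemma mem_boxes_or_roofDot (hk : ∀ j, 0 < k j) {x y : ℕ} (h : (x, y) ∈ dots k) :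
    (x, y) ∈ boxes k ∨ ∃ i < l, RoofDot k i (x, y) := by
  rw [mem_dots] at h
  -- the first column of the staircase that contains `x`
  classical
  have hex : ∃ i, i < l ∧ x < flagDim k (i + 1) := by
    obtain ⟨i, h1, h2, -⟩ := h
    exact ⟨i, h1, h2⟩
  obtain ⟨i, ⟨hi, hx⟩, hmin⟩ : ∃ i, (i < l ∧ x < flagDim k (i + 1)) ∧
      ∀ j < i, ¬(j < l ∧ x < flagDim k (j + 1)) :=
    ⟨Nat.find hex, Nat.find_spec hex, fun j => Nat.find_min hex⟩
  have hy : y + flagDim k (i + 1) < total k := by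
    obtain ⟨j, h1, h2, h3⟩ := h
    have : i ≤ j := by
      by_contra h4
      exact hmin j (by omega) ⟨h1, h2⟩
    have := flagDim_mono (k := k) (show i + 1 ≤ j + 1 by omega)
    omega
  have hx' : flagDim k i ≤ x := by
    rcases hi0 : i with _ | j
    · rw [flagDim_zero]
      omega
    · by_contra h4
      exact hmin j (by omega) ⟨by omega, by omega⟩
  have h0 := flagDim_lt hk (show i + 1 < i + 2 by omega) (by omega)
  rw [mem_boxes hk, mem_vertices, mem_dots]
  by_contra hcon
  push Not at hcon
  obtain ⟨⟨h1, h2⟩, h3⟩ := hcon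
  have h4 := h1 i hi
  have h5 := h2 (i + 1) (by omega)
  have h6 := h3 i hi
  simp only [RoofDot] at h6
  by_cases hl : i + 1 < l
  · have h7 := h1 (i + 1) hl
    simp only [add_assoc, Nat.reduceAdd] at h5 h7
    omega
  · obtain rfl : i + 1 = l := by omega
    simp only [total] at *
    simp only [add_assoc, Nat.reduceAdd] at *
    omega

lemma mem_edges (hk : ∀ j, 0 < k j) {e : (ℕ × ℕ) × (ℕ × ℕ)} : e ∈ edges k ↔ ∃ x y,
    (e = ((x, y), (x + 1, y)) ∧ (x + 1, y) ∈ vertices k) ∨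
      (e = ((x, y + 1), (x, y)) ∧ (x, y + 1) ∈ vertices k) := by
  obtain ⟨⟨x, y⟩, ⟨x', y'⟩⟩ := e
  simp only [edges, Finset.mem_filter, Finset.mem_product, Prod.mk_add_mk, Prod.mk.injEq, add_zero]
  constructor
  · rintro ⟨⟨h1, h2⟩, ⟨rfl, rfl⟩ | ⟨rfl, rfl⟩⟩
    · exact ⟨x, y', .inl ⟨by simp, h2⟩⟩
    · exact ⟨x, y', .inr ⟨by simp, h1⟩⟩
  · rintro ⟨a, b, ⟨⟨⟨rfl, rfl⟩, rfl, rfl⟩, h⟩ | ⟨⟨⟨rfl, rfl⟩, rfl, rfl⟩, h⟩⟩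
    · exact ⟨⟨dots_subset_vertices (mem_dots_of_right hk h), h⟩, .inl ⟨rfl, rfl⟩⟩
    · exact ⟨⟨h, dots_subset_vertices (mem_dots_of_up hk h)⟩, .inr ⟨rfl, rfl⟩⟩

/-! ### The roofs as paths -/

lemma onRoof_iff (i : Fin l) (x y : ℕ) : OnRoof k i (x, y) ↔
    (x = flagDim k i ∧ y + flagDim k (i + 1) = total k) ∨ RoofDot k i (x, y) ∨
      (x = flagDim k (i + 1) ∧ y + flagDim k (i + 2) = total k) := by
  have h1 := flagDim_le_total (k := k) (i := i + 1) (by omega)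
  have h2 := flagDim_le_total (k := k) (i := i + 2) (by omega)
  simp only [OnRoof, RoofDot, star, Prod.mk.injEq, Fin.val_castSucc, Fin.val_succ, add_assoc,
    Nat.reduceAdd]
  omega

variable (k) in
/-- The vertices of a roof, numbered from one star to the next: first down by one step, then along
the top row, then down along the right column, and finally right by one step. -/
def roofPath (i j : ℕ) : ℕ × ℕ :=
  if j = 0 then (flagDim k i, total k - flagDim k (i + 1))
  else if flagDim k i + j ≤ flagDim k (i + 1) then
    (flagDim k i + j - 1, total k - flagDim k (i + 1) - 1)
  else if flagDim k i + j < flagDim k (i + 2) then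
    (flagDim k (i + 1) - 1, total k - (flagDim k i + j + 1))
  else (flagDim k (i + 1), total k - flagDim k (i + 2))

variable (k) in
/-- The number `k_i + k_{i+1}` of edges of a roof. -/
def roofLength (i : ℕ) : ℕ := flagDim k (i + 2) - flagDim k i

lemma roofLength_eq (i : Fin l) : roofLength k i = k i.castSucc + k i.succ := by
  have h1 := flagDim_succ (k := k) i.castSucc
  have h2 := flagDim_succ (k := k) i.succ
  simp only [Fin.val_castSucc, Fin.val_succ, add_assoc, Nat.reduceAdd] at h1 h2
  simp only [roofLength]
  omega

lemma roof_bounds (hk : ∀ j, 0 < k j) {i : ℕ} (hi : i < l) :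
    flagDim k i < flagDim k (i + 1) ∧ flagDim k (i + 1) < flagDim k (i + 2) ∧
      flagDim k (i + 2) ≤ total k :=
  ⟨flagDim_lt hk (by omega) (by omega), flagDim_lt hk (by omega) (by omega),
    flagDim_le_total (by omega)⟩

lemma roofDot_iff (hk : ∀ j, 0 < k j) {i : ℕ} (hi : i < l) (p : ℕ × ℕ) :
    RoofDot k i p ↔ ∃ j, j + 1 < roofLength k i ∧ p = roofPath k i (j + 1) := by
  obtain ⟨x, y⟩ := p
  obtain ⟨h1, h2, h3⟩ := roof_bounds hk hi
  simp only [RoofDot, roofLength, roofPath]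
  constructor
  · intro h
    refine ⟨x + (total k - y) - flagDim k i - flagDim k (i + 1) - 1, by omega, ?_⟩
    split_ifs <;> first | contradiction | (rw [Prod.mk.injEq]; omega)
  · rintro ⟨j, hj, h⟩
    split_ifs at h <;> first | contradiction | (rw [Prod.mk.injEq] at h; omega)

lemma roofPath_zero (i : ℕ) :
    roofPath k i 0 = (flagDim k i, total k - flagDim k (i + 1)) := if_pos rfl

lemma roofPath_length (hk : ∀ j, 0 < k j) {i : ℕ} (hi : i < l) :
    roofPath k i (roofLength k i) = (flagDim k (i + 1), total k - flagDim k (i + 2)) := by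
  obtain ⟨h1, h2, h3⟩ := roof_bounds hk hi
  rw [roofPath, roofLength, if_neg (by omega), if_neg (by omega), if_neg (by omega)]

lemma roofPath_fst_add (hk : ∀ j, 0 < k j) {i j : ℕ} (hi : i < l) (hj : j ≤ roofLength k i) :
    (roofPath k i j).1 + total k = flagDim k i + flagDim k (i + 1) + j + (roofPath k i j).2 := by
  obtain ⟨h1, h2, h3⟩ := roof_bounds hk hi
  simp only [roofPath, roofLength] at hj ⊢
  split_ifs <;> omega

lemma roofPath_injOn (hk : ∀ j, 0 < k j) {i j j' : ℕ} (hi : i < l) (hj : j ≤ roofLength k i)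
    (hj' : j' ≤ roofLength k i) (h : roofPath k i j = roofPath k i j') : j = j' := by
  have h1 := roofPath_fst_add hk hi hj
  have h2 := roofPath_fst_add hk hi hj'
  rw [h] at h1
  omega

lemma onRoof_iff_roofPath (hk : ∀ j, 0 < k j) (i : Fin l) (p : ℕ × ℕ) :
    OnRoof k i p ↔ ∃ j ≤ roofLength k i, p = roofPath k i j := by
  obtain ⟨x, y⟩ := p
  obtain ⟨h1, h2, h3⟩ := roof_bounds hk i.2
  have h0 : 0 < roofLength k i := by
    simp only [roofLength]
    omega
  rw [onRoof_iff, roofDot_iff hk i.2]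
  constructor
  · rintro (h | ⟨j, hj, h⟩ | h)
    · refine ⟨0, by omega, ?_⟩
      rw [roofPath_zero, Prod.mk.injEq]
      omega
    · exact ⟨j + 1, by omega, h⟩
    · refine ⟨_, le_rfl, ?_⟩
      rw [roofPath_length hk i.2, Prod.mk.injEq]
      omega
  · rintro ⟨j, hj, h⟩
    rcases Nat.eq_zero_or_pos j with rfl | h4
    · rw [roofPath_zero, Prod.mk.injEq] at h
      omega
    · rcases eq_or_lt_of_le hj with rfl | h5
      · rw [roofPath_length hk i.2, Prod.mk.injEq] at h
        omega
      · exact .inr (.inl ⟨j - 1, by omega, by rwa [Nat.sub_add_cancel h4]⟩)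

lemma roofPath_succ (hk : ∀ j, 0 < k j) {i j : ℕ} (hi : i < l) (hj : j < roofLength k i) :
    (∃ x y, roofPath k i j = (x, y) ∧ roofPath k i (j + 1) = (x + 1, y)) ∨
      ∃ x y, roofPath k i j = (x, y + 1) ∧ roofPath k i (j + 1) = (x, y) := by
  obtain ⟨h1, h2, h3⟩ := roof_bounds hk hi
  generalize ha : roofPath k i j = a
  generalize hb : roofPath k i (j + 1) = b
  obtain ⟨x, y⟩ := a
  obtain ⟨x', y'⟩ := b
  suffices (x' = x + 1 ∧ y' = y) ∨ (x' = x ∧ y = y' + 1) by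
    rcases this with ⟨rfl, rfl⟩ | ⟨rfl, rfl⟩
    · exact .inl ⟨_, _, rfl, rfl⟩
    · exact .inr ⟨_, _, rfl, rfl⟩
  simp only [roofPath, roofLength] at ha hb hj
  split_ifs at ha hb <;> first | contradiction | (rw [Prod.mk.injEq] at ha hb; omega)

lemma onRoof_mem_vertices {i : Fin l} {p : ℕ × ℕ} (h : OnRoof k i p) : p ∈ vertices k := by
  obtain ⟨x, y⟩ := p
  rw [onRoof_iff] at h
  rw [mem_vertices]
  rcases h with h | h | h
  · exact .inr ⟨i, by omega, h.1, h.2⟩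
  · exact .inl (h.mem_dots i.2)
  · exact .inr ⟨i + 1, by omega, h.1, h.2⟩

lemma roofPath_mem_edges (hk : ∀ j, 0 < k j) (i : Fin l) {j : ℕ} (hj : j < roofLength k i) :
    (roofPath k i j, roofPath k i (j + 1)) ∈ edges k := by
  have h1 := onRoof_mem_vertices ((onRoof_iff_roofPath hk i _).2 ⟨j, hj.le, rfl⟩)
  have h2 := onRoof_mem_vertices ((onRoof_iff_roofPath hk i _).2 ⟨j + 1, hj, rfl⟩)
  rw [mem_edges hk]
  rcases roofPath_succ hk i.2 hj with ⟨x, y, h3, h4⟩ | ⟨x, y, h3, h4⟩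
  · rw [h4] at h2
    exact ⟨x, y, .inl ⟨by rw [h3, h4], h2⟩⟩
  · rw [h3] at h1
    exact ⟨x, y, .inr ⟨by rw [h3, h4], h1⟩⟩

lemma roof_map_val (hk : ∀ j, 0 < k j) (i : Fin l) :
    (roof k i).map (Function.Embedding.subtype _) =
      (Finset.range (roofLength k i)).image fun j => (roofPath k i j, roofPath k i (j + 1)) := by
  ext e
  simp only [roof, Finset.mem_map, Finset.mem_filter, Finset.mem_univ, true_and, Finset.mem_image,
    Finset.mem_range, Function.Embedding.subtype_apply, onRoof_iff_roofPath hk]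
  constructor
  · rintro ⟨⟨e, he⟩, ⟨⟨j, hj, h1⟩, j', hj', h2⟩, rfl⟩
    have h3 := roofPath_fst_add hk i.2 hj
    have h4 := roofPath_fst_add hk i.2 hj'
    have h5 : j' = j + 1 := by
      rw [← h1] at h3
      rw [← h2] at h4
      rw [mem_edges hk] at he
      rcases he with ⟨x, y, ⟨rfl, -⟩ | ⟨rfl, -⟩⟩ <;> simp only at h3 h4 <;> omega
    subst h5
    exact ⟨j, by omega, Prod.ext h1.symm h2.symm⟩
  · rintro ⟨j, hj, rfl⟩
    exact ⟨⟨_, roofPath_mem_edges hk i hj⟩, ⟨⟨j, hj.le, rfl⟩, j + 1, hj, rfl⟩, rfl⟩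

lemma sum_roof (hk : ∀ j, 0 < k j) (i : Fin l) {A : Type*} [AddCommMonoid A]
    (f : (ℕ × ℕ) × (ℕ × ℕ) → A) : ∑ e ∈ roof k i, f e.1 =
      ∑ j ∈ Finset.range (roofLength k i), f (roofPath k i j, roofPath k i (j + 1)) := by
  have h := Finset.sum_map (roof k i) (Function.Embedding.subtype _) f
  rw [roof_map_val hk] at h
  rw [show ∑ e ∈ roof k i, f e.1 = _ from h.symm, Finset.sum_image]
  intro a ha b hb hab
  simp only [Finset.coe_range, Set.mem_Iio] at ha hb
  exact roofPath_injOn hk i.2 ha.le hb.le (Prod.mk.inj hab).1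

lemma card_roof (hk : ∀ j, 0 < k j) (i : Fin l) : (roof k i).card = roofLength k i := by
  rw [Finset.card_eq_sum_ones, sum_roof hk i fun _ => 1]
  simp

open Classical in
lemma card_roofDot (hk : ∀ j, 0 < k j) {i : ℕ} (hi : i < l) :
    ((dots k).filter fun p => RoofDot k i p).card + 1 = roofLength k i := by
  have h : (dots k).filter (fun p => RoofDot k i p) =
      (Finset.range (roofLength k i - 1)).image fun j => roofPath k i (j + 1) := by
    ext p
    simp only [Finset.mem_filter, Finset.mem_image, Finset.mem_range]
    rw [and_iff_right_of_imp fun h => h.mem_dots hi, roofDot_iff hk hi]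
    refine exists_congr fun j => ?_
    rw [eq_comm (a := p)]
    exact and_congr_left' (by omega)
  obtain ⟨h1, h2, h3⟩ := roof_bounds hk hi
  have h0 : 0 < roofLength k i := by
    simp only [roofLength]
    omega
  rw [h, Finset.card_image_of_injOn, Finset.card_range, Nat.sub_add_cancel h0]
  intro a ha b hb hab
  simp only [Finset.coe_range, Set.mem_Iio] at ha hb
  have := roofPath_injOn hk hi (by omega) (by omega) hab
  omega

/-! ### The ladder diagram as a triangular system -/

/-- Every edge is the bottom or the left side of the unit square over its left or lower end. -/
lemma edge_cases (hk : ∀ j, 0 < k j) (e : Edge k) : ∃ x y,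
    (e.1 = ((x, y), (x + 1, y)) ∧ (x + 1, y) ∈ vertices k) ∨
      (e.1 = ((x, y + 1), (x, y)) ∧ (x, y + 1) ∈ vertices k) := (mem_edges hk).1 e.2

/-- The left or lower end of an edge. -/
def base (e : Edge k) : ℕ × ℕ := (e.1.1.1, e.1.2.2)

lemma base_mem_dots (hk : ∀ j, 0 < k j) (e : Edge k) : base e ∈ dots k := by
  obtain ⟨x, y, ⟨h, h'⟩ | ⟨h, h'⟩⟩ := edge_cases hk e <;> simp only [base, h]
  · exact mem_dots_of_right hk h'
  · exact mem_dots_of_up hk h'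

open Classical in
/-- The box with a given lower left vertex or the roof through that vertex. -/
noncomputable def cell (hk : ∀ j, 0 < k j) (p : ↥(dots k)) : Idx k :=
  if h : p.1 ∈ boxes k then .inr ⟨p.1, h⟩ else
    have h' : ∃ i : Fin l, RoofDot k i p.1 := by
      obtain ⟨i, hi, h'⟩ := (mem_boxes_or_roofDot hk p.2).resolve_left h
      exact ⟨⟨i, hi⟩, h'⟩
    .inl h'.choose

lemma cell_eq_inr (hk : ∀ j, 0 < k j) (p : ↥(dots k)) (b : Box k) :
    cell hk p = .inr b ↔ p.1 = b.1 := by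
  unfold cell
  split_ifs with h
  · rw [Sum.inr.injEq, Subtype.ext_iff]
  · simp only [false_iff]
    exact fun h' => h (h' ▸ b.2)

lemma cell_eq_inl (hk : ∀ j, 0 < k j) (p : ↥(dots k)) (i : Fin l) :
    cell hk p = .inl i ↔ RoofDot k i p.1 := by
  unfold cell
  split_ifs with h
  · simp only [false_iff]
    exact fun h' => h'.not_mem_boxes hk i.2 h
  · have h' : ∃ i : Fin l, RoofDot k i p.1 := by
      obtain ⟨i, hi, h'⟩ := (mem_boxes_or_roofDot hk p.2).resolve_left h
      exact ⟨⟨i, hi⟩, h'⟩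
    rw [Sum.inl.injEq]
    refine ⟨fun h1 => h1 ▸ h'.choose_spec, fun h1 => ?_⟩
    exact Fin.ext (h'.choose_spec.eq hk h'.choose.2 i.2 h1)

/-- The equation on whose left side an edge occurs: a corner or a roof. -/
noncomputable def edgeHead (hk : ∀ j, 0 < k j) (e : Edge k) : Idx k :=
  cell hk ⟨base e, base_mem_dots hk e⟩

lemma edgeHead_eq_inr (hk : ∀ j, 0 < k j) (e : Edge k) (b : Box k) :
    edgeHead hk e = .inr b ↔ e ∈ corner k b := by
  rw [edgeHead, cell_eq_inr]
  obtain ⟨⟨a, c⟩, hb⟩ := b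
  obtain ⟨x, y, ⟨h, h'⟩ | ⟨h, h'⟩⟩ := edge_cases hk e <;>
    simp only [base, corner, Finset.mem_filter, Finset.mem_univ, true_and, h, Prod.mk.injEq,
      Prod.mk_add_mk, add_zero] <;> omega

lemma roofDot_iff_onRoof_right (hk : ∀ j, 0 < k j) (i : Fin l) {x y : ℕ}
    (h : (x + 1, y) ∈ vertices k) :
    RoofDot k i (x, y) ↔ OnRoof k i (x, y) ∧ OnRoof k i (x + 1, y) := by
  obtain ⟨h1, h2, h3⟩ := roof_bounds hk i.2
  rw [onRoof_iff, onRoof_iff]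
  simp only [RoofDot]
  refine ⟨fun h4 => ⟨.inr (.inl h4), ?_⟩, by omega⟩
  rw [mem_vertices, mem_dots] at h
  rcases h with ⟨j, hj, h5, h6⟩ | ⟨j, hj, h5, h6⟩
  · rcases le_or_gt j i with h7 | h7
    · have := flagDim_mono (k := k) (show j + 1 ≤ i + 1 by omega)
      omega
    · have := flagDim_mono (k := k) (show i.1 + 2 ≤ j + 1 by omega)
      omega
  · have := flagDim_lt hk (show j < j + 1 by omega) hj
    rcases lt_or_ge i.1 j with h7 | h7
    · have := flagDim_mono (k := k) (show i.1 + 2 ≤ j + 1 by omega)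
      have := flagDim_mono (k := k) (show i.1 + 1 ≤ j by omega)
      omega
    · have := flagDim_mono (k := k) (show j + 1 ≤ i + 1 by omega)
      omega

lemma roofDot_iff_onRoof_up (hk : ∀ j, 0 < k j) (i : Fin l) {x y : ℕ}
    (h : (x, y + 1) ∈ vertices k) :
    RoofDot k i (x, y) ↔ OnRoof k i (x, y + 1) ∧ OnRoof k i (x, y) := by
  obtain ⟨h1, h2, h3⟩ := roof_bounds hk i.2
  rw [onRoof_iff, onRoof_iff]
  simp only [RoofDot]
  refine ⟨fun h4 => ⟨?_, .inr (.inl h4)⟩, by omega⟩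
  rw [mem_vertices, mem_dots] at h
  rcases h with ⟨j, hj, h5, h6⟩ | ⟨j, hj, h5, h6⟩
  · rcases lt_or_ge j i with h7 | h7
    · have := flagDim_mono (k := k) (show j + 1 ≤ i by omega)
      omega
    · have := flagDim_mono (k := k) (show i.1 + 1 ≤ j + 1 by omega)
      omega
  · have := flagDim_lt hk (show j < j + 1 by omega) hj
    rcases lt_trichotomy j i.1 with h7 | h7 | h7
    · have := flagDim_mono (k := k) (show j + 1 ≤ i by omega)
      omega
    · subst h7
      omega
    · have := flagDim_mono (k := k) (show i.1 + 2 ≤ j + 1 by omega)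
      have := flagDim_mono (k := k) (show i.1 + 1 ≤ j by omega)
      omega

lemma edgeHead_eq_inl (hk : ∀ j, 0 < k j) (e : Edge k) (i : Fin l) :
    edgeHead hk e = .inl i ↔ e ∈ roof k i := by
  rw [edgeHead, cell_eq_inl]
  simp only [roof, Finset.mem_filter, Finset.mem_univ, true_and]
  obtain ⟨x, y, ⟨h, h'⟩ | ⟨h, h'⟩⟩ := edge_cases hk e <;> simp only [base, h]
  · exact roofDot_iff_onRoof_right hk i h'
  · exact roofDot_iff_onRoof_up hk i h'

open Classical in
/-- The equation on whose right side an edge occurs, if any: an opposite corner. -/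
noncomputable def edgeTail (e : Edge k) : Option (Idx k) :=
  if h : ∃ b, e ∈ oppCorner k b then some (.inr h.choose) else none

lemma oppCorner_unique {e : Edge k} {b b' : Box k} (h : e ∈ oppCorner k b)
    (h' : e ∈ oppCorner k b') : b = b' := by
  obtain ⟨⟨x, y⟩, hb⟩ := b
  obtain ⟨⟨x', y'⟩, hb'⟩ := b'
  simp only [oppCorner, Finset.mem_filter, Finset.mem_univ, true_and, Prod.mk_add_mk,
    add_zero] at h h'
  rw [Subtype.mk.injEq, Prod.mk.injEq]
  rcases h with h | h <;> rcases h' with h' | h' <;>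
    simp only [h, Prod.mk.injEq] at h' <;> omega

lemma edgeTail_eq_inr (e : Edge k) (b : Box k) :
    edgeTail e = some (.inr b) ↔ e ∈ oppCorner k b := by
  unfold edgeTail
  split_ifs with h
  · rw [Option.some.injEq, Sum.inr.injEq]
    exact ⟨fun h1 => h1 ▸ h.choose_spec, fun h1 => oppCorner_unique h.choose_spec h1⟩
  · simp only [false_iff]
    exact fun h1 => h ⟨b, h1⟩

lemma edgeTail_ne_inl (e : Edge k) (i : Fin l) : edgeTail e ≠ some (.inl i) := by
  unfold edgeTail
  split_ifs <;> simp

variable (k) in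
/-- The antidiagonal of a box; the roofs lie above all boxes. -/
def idxRank : Idx k → ℕ := Sum.elim (fun _ => 2 * total k) fun b => b.1.1 + b.1.2

-- Otherwise definitional unfolding runs into the decision procedures for membership in the finite
-- sets of lattice points.
attribute [irreducible] edgeHead edgeTail

/-- The equations of the ladder diagram, to be solved for the edges that are left out. -/
noncomputable def system (hk : ∀ j, 0 < k j) (σ : MaxCone k) :
    TriangularSystem (Edge k) (Idx k) where
  head := edgeHead hk
  tail := edgeTail
  rank := idxRank k
  rank_lt e b h := by
    obtain ⟨i⟩ | b := b
    · exact absurd h (edgeTail_ne_inl e _)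
    · rw [edgeTail_eq_inr] at h
      rcases h1 : edgeHead hk e with i | b'
      · obtain ⟨⟨x, y⟩, hb⟩ := b
        have := box_mem_dots hk hb
        simp only [dots, Finset.mem_filter, Finset.mem_product, Finset.mem_range] at this
        simp only [idxRank, Sum.elim_inl, Sum.elim_inr]
        omega
      · rw [edgeHead_eq_inr] at h1
        obtain ⟨⟨x, y⟩, hb⟩ := b
        obtain ⟨⟨x', y'⟩, hb'⟩ := b'
        simp only [oppCorner, corner, Finset.mem_filter, Finset.mem_univ, true_and,
          Prod.mk_add_mk, add_zero] at h h1
        simp only [idxRank, Sum.elim_inr]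
        rcases h with h | h <;> rcases h1 with h1 | h1 <;>
          simp only [h, Prod.mk.injEq] at h1 <;> omega
  pivot := σ.dropped
  head_pivot a := by
    obtain i | b := a
    · exact (edgeHead_eq_inl hk _ _).2 (σ.dropped_roof i)
    · exact (edgeHead_eq_inr hk _ _).2 (σ.dropped_corner b)

variable (hk : ∀ j, 0 < k j) (σ : MaxCone k)

lemma system_head (e : Edge k) : (system hk σ).head e = edgeHead hk e := rfl

lemma system_tail (e : Edge k) : (system hk σ).tail e = edgeTail e := rfl

lemma filter_head_inl (i : Fin l) :
    (Finset.univ.filter fun e => (system hk σ).head e = .inl i) = roof k i := by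
  ext e
  simp [system_head, edgeHead_eq_inl]

lemma filter_head_inr (b : Box k) :
    (Finset.univ.filter fun e => (system hk σ).head e = .inr b) = corner k b := by
  ext e
  simp [system_head, edgeHead_eq_inr]

lemma filter_tail_inl (i : Fin l) :
    (Finset.univ.filter fun e => (system hk σ).tail e = some (.inl i)) = ∅ := by
  ext e
  simp [system_tail, edgeTail_ne_inl]

lemma filter_tail_inr (b : Box k) :
    (Finset.univ.filter fun e => (system hk σ).tail e = some (.inr b)) = oppCorner k b := by
  ext e
  simp [system_tail, edgeTail_eq_inr]

lemma eqn_eq (q : Fin l → ℂ) (qt : Box k → ℂ) (a : Idx k) :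
    eqn k q qt a = (system hk σ).eqn (Sum.elim q qt) a := by
  funext y
  obtain i | b := a
  · simp only [eqn, TriangularSystem.eqn, filter_head_inl, filter_tail_inl, Sum.elim_inl,
      Finset.prod_empty, mul_one]
  · simp only [eqn, TriangularSystem.eqn, filter_head_inr, filter_tail_inr, Sum.elim_inr]

/-! ### The edges of a box -/

lemma corner_edges_mem (hk : ∀ j, 0 < k j) (b : Box k) :
    (b.1 + (0, 1), b.1) ∈ edges k ∧ (b.1, b.1 + (1, 0)) ∈ edges k ∧
      (b.1 + (0, 1), b.1 + (1, 1)) ∈ edges k ∧ (b.1 + (1, 1), b.1 + (1, 0)) ∈ edges k := by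
  obtain ⟨⟨x, y⟩, hb⟩ := b
  have h := (mem_boxes hk).1 hb
  have h1 := dots_subset_vertices (mem_dots_of_right hk h)
  have h2 := dots_subset_vertices (mem_dots_of_up hk h)
  simp only [mem_edges hk, Prod.mk_add_mk, add_zero]
  exact ⟨⟨x, y, .inr ⟨rfl, h1⟩⟩, ⟨x, y, .inl ⟨rfl, h2⟩⟩, ⟨x, y + 1, .inl ⟨rfl, h⟩⟩,
    ⟨x + 1, y, .inr ⟨rfl, h⟩⟩⟩

lemma corner_eq (hk : ∀ j, 0 < k j) (b : Box k) : corner k b =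
    {⟨_, (corner_edges_mem hk b).1⟩, ⟨_, (corner_edges_mem hk b).2.1⟩} := by
  ext e
  simp [corner, Subtype.ext_iff]

lemma oppCorner_eq (hk : ∀ j, 0 < k j) (b : Box k) : oppCorner k b =
    {⟨_, (corner_edges_mem hk b).2.2.1⟩, ⟨_, (corner_edges_mem hk b).2.2.2⟩} := by
  ext e
  simp [oppCorner, Subtype.ext_iff]

lemma sum_corner (hk : ∀ j, 0 < k j) (b : Box k) {A : Type*} [AddCommMonoid A] (f : (ℕ × ℕ) × (ℕ × ℕ) → A) :
    ∑ e ∈ corner k b, f e.1 = f (b.1 + (0, 1), b.1) + f (b.1, b.1 + (1, 0)) := by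
  rw [corner_eq hk, Finset.sum_pair]
  simp [Subtype.ext_iff, Prod.ext_iff]

lemma sum_oppCorner (hk : ∀ j, 0 < k j) (b : Box k) {A : Type*} [AddCommMonoid A] (f : (ℕ × ℕ) × (ℕ × ℕ) → A) :
    ∑ e ∈ oppCorner k b, f e.1 =
      f (b.1 + (0, 1), b.1 + (1, 1)) + f (b.1 + (1, 1), b.1 + (1, 0)) := by
  rw [oppCorner_eq hk, Finset.sum_pair]
  simp [Subtype.ext_iff, Prod.ext_iff]

lemma card_corner (hk : ∀ j, 0 < k j) (b : Box k) : (corner k b).card = 2 := by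
  rw [Finset.card_eq_sum_ones, sum_corner hk b fun _ => 1]

lemma card_oppCorner (hk : ∀ j, 0 < k j) (b : Box k) : (oppCorner k b).card = 2 := by
  rw [Finset.card_eq_sum_ones, sum_oppCorner hk b fun _ => 1]

/-! ### Euler's formula -/

/-- The graph has as many dots as there are edges that are not left out. -/
lemma card_free : Fintype.card (system hk σ).Free = (dots k).card := by
  classical
  have h1 : Fintype.card (Edge k) = Fintype.card (Idx k) + Fintype.card (system hk σ).Free := by
    rw [← Fintype.card_sum]
    exact (Fintype.card_congr (system hk σ).coordEquiv).symm
  have h2 : Fintype.card (Edge k) = ∑ a, (Finset.univ.filter fun e => edgeHead hk e = a).card :=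
    Finset.card_eq_sum_card_fiberwise fun _ _ => Finset.mem_coe.2 (Finset.mem_univ _)
  have h3 : Fintype.card ↥(dots k) = ∑ a, (Finset.univ.filter fun p => cell hk p = a).card :=
    Finset.card_eq_sum_card_fiberwise fun _ _ => Finset.mem_coe.2 (Finset.mem_univ _)
  have h4 : ∀ a, (Finset.univ.filter fun e => edgeHead hk e = a).card =
      (Finset.univ.filter fun p => cell hk p = a).card + 1 := by
    rintro (i | b)
    · simp only [edgeHead_eq_inl, cell_eq_inl, Finset.filter_univ_mem, card_roof hk]
      rw [← card_roofDot hk i.2, ← Finset.card_map (Function.Embedding.subtype _)]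
      congr 2
      ext p
      simp
      tauto
    · simp only [edgeHead_eq_inr, cell_eq_inr, Finset.filter_univ_mem, card_corner hk]
      have : (Finset.univ.filter fun p : ↥(dots k) => p.1 = b.1) =
          {⟨b.1, box_mem_dots hk b.2⟩} := by
        ext p
        simp [Subtype.ext_iff]
      rw [this, Finset.card_singleton]
  simp only [h4, Finset.sum_add_distrib, Finset.sum_const, Finset.card_univ, smul_eq_mul,
    mul_one] at h2
  rw [Fintype.card_coe] at h3
  omega

/-! ### Potentials and the cones of the fan -/

/-- A function on the dots, extended by zero to the stars. -/
noncomputable def potential (u : ↥(dots k) → ℝ) (p : ℕ × ℕ) : ℝ :=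
  if h : p ∈ dots k then u ⟨p, h⟩ else 0

lemma sum_mul_delta (u : ↥(dots k) → ℝ) (e : Edge k) :
    ∑ d, u d * delta k e d = potential u e.1.2 - potential u e.1.1 := by
  have h : ∀ p : ℕ × ℕ, ∑ d : ↥(dots k), u d * (if p = d.1 then 1 else 0) = potential u p := by
    intro p
    unfold potential
    split_ifs with hp
    · rw [Finset.sum_eq_single ⟨p, hp⟩]
      · simp
      · intro d _ hd
        rw [if_neg fun h => hd (Subtype.ext h.symm), mul_zero]
      · simp
    · refine Finset.sum_eq_zero fun d _ => ?_
      rw [if_neg fun h : p = d.1 => hp (h ▸ d.2), mul_zero]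
  simp only [delta, mul_sub, Finset.sum_sub_distrib, h]

lemma potential_roofPath_zero (u : ↥(dots k) → ℝ) {i : ℕ} (hi : i < l) :
    potential u (roofPath k i 0) = 0 := by
  have := flagDim_le_total (k := k) (i := i + 1) (by omega)
  rw [roofPath_zero, potential, dif_neg (star_not_mem_dots rfl (by omega))]

lemma potential_roofPath_length (hk : ∀ j, 0 < k j) (u : ↥(dots k) → ℝ) {i : ℕ} (hi : i < l) :
    potential u (roofPath k i (roofLength k i)) = 0 := by
  have : flagDim k (i + 1 + 1) ≤ total k := flagDim_le_total (by omega)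
  rw [roofPath_length hk hi, potential, dif_neg (star_not_mem_dots rfl (Nat.sub_add_cancel this))]

variable (hk : ∀ j, 0 < k j) (σ : MaxCone k)

/-- The differential of a potential solves the homogeneous system: it sums to zero over a roof, and
to the same value over both corners of a box. -/
lemma sum_potential_head (u : ↥(dots k) → ℝ) (a : Idx k) :
    ∑ e with (system hk σ).head e = a, (potential u e.1.2 - potential u e.1.1) =
      ∑ e with (system hk σ).tail e = some a, (potential u e.1.2 - potential u e.1.1) := by
  obtain i | b := a
  · rw [filter_head_inl, filter_tail_inl, Finset.sum_empty,
      sum_roof hk i fun e => potential u e.2 - potential u e.1,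
      Finset.sum_range_sub fun j => potential u (roofPath k i j),
      potential_roofPath_zero u i.2, potential_roofPath_length hk u i.2, sub_zero]
  · rw [filter_head_inr, filter_tail_inr,
      sum_corner hk b fun e => potential u e.2 - potential u e.1,
      sum_oppCorner hk b fun e => potential u e.2 - potential u e.1]
    ring

/-- A potential with vanishing differential is zero, since every dot is joined with a star. -/
lemma eq_zero_of_potential_eq (hk : ∀ j, 0 < k j) (u : ↥(dots k) → ℝ)
    (h : ∀ e : Edge k, potential u e.1.2 = potential u e.1.1) : u = 0 := by
  suffices H : ∀ n x y, (x, y) ∈ dots k → total k - x = n → potential u (x, y) = 0 by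
    funext p
    have := H _ p.1.1 p.1.2 p.2 rfl
    simpa [potential] using this
  intro n
  induction n with
  | zero =>
    intro x y hp hx
    obtain ⟨i, hi, h1, -⟩ := mem_dots.1 hp
    have := flagDim_le_total (k := k) (i := i + 1) (by omega)
    omega
  | succ n ih =>
    intro x y hp hx
    rcases mem_boxes_or_roofDot hk hp with hb | ⟨i, hi, hr⟩
    · have he := h ⟨_, (corner_edges_mem hk ⟨_, hb⟩).2.1⟩
      simp only [Prod.mk_add_mk, add_zero] at he
      rw [← he]
      by_cases hp' : (x + 1, y) ∈ dots k
      · exact ih _ _ hp' (by omega)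
      · exact dif_neg hp'
    · obtain ⟨j, hj, hr⟩ := (roofDot_iff hk hi _).1 hr
      rw [hr]
      have key : ∀ j, j ≤ roofLength k i → potential u (roofPath k i j) = 0 := by
        intro j
        induction j with
        | zero => exact fun _ => potential_roofPath_zero u hi
        | succ j ihj =>
          intro hj
          rw [← ihj (by omega)]
          exact h ⟨_, roofPath_mem_edges hk ⟨i, hi⟩ hj⟩
      exact key _ hj.le

/-- The values of the differential of a potential at the edges that are not left out are arbitrary,
that is, the vectors `δ(e)` for these edges are linearly independent. -/
lemma exists_potential (c : (system hk σ).Free → ℝ) : ∃ u : ↥(dots k) → ℝ,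
    ∀ g : (system hk σ).Free, potential u g.1.1.2 - potential u g.1.1.1 = c g := by
  let d : (↥(dots k) → ℝ) →ₗ[ℝ] ((system hk σ).Free → ℝ) :=
    { toFun := fun u g => ∑ d, u d * delta k g.1 d
      map_add' := fun u v => by
        funext g
        simp [add_mul, Finset.sum_add_distrib]
      map_smul' := fun r u => by
        funext g
        simp [mul_assoc, Finset.mul_sum] }
  have hd : Function.Injective d := by
    rw [injective_iff_map_eq_zero]
    intro u hu
    refine eq_zero_of_potential_eq hk u fun e => sub_eq_zero.1 ?_
    refine (system hk σ).eq_zero_of_homogeneous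
      (fun e => potential u e.1.2 - potential u e.1.1) 0
      (fun a _ => sum_potential_head hk σ u a) (fun e he _ => ?_) e (Nat.zero_le _)
    rw [← sum_mul_delta]
    exact congrFun hu ⟨e, he⟩
  have hd' := (LinearMap.injective_iff_surjective_of_finrank_eq_finrank (f := d) (by
    rw [Module.finrank_fintype_fun_eq_card, Module.finrank_fintype_fun_eq_card, card_free hk σ,
      Fintype.card_coe])).1 hd
  obtain ⟨u, hu⟩ := hd' c
  refine ⟨u, fun g => ?_⟩
  rw [← sum_mul_delta]
  exact congrFun hu g

/-- Every equation has an edge on its left side that is not left out. -/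
lemma exists_free_head (a : Idx k) : ∃ g : (system hk σ).Free, (system hk σ).head g.1 = a := by
  have hcard : 1 < (Finset.univ.filter fun e => (system hk σ).head e = a).card := by
    obtain i | b := a
    · obtain ⟨h1, h2, h3⟩ := roof_bounds hk i.2
      rw [filter_head_inl, card_roof hk, roofLength]
      omega
    · rw [filter_head_inr, card_corner hk]
      omega
  obtain ⟨e, he, hne⟩ := Finset.exists_mem_ne hcard ((system hk σ).pivot a)
  simp only [Finset.mem_filter, Finset.mem_univ, true_and] at he
  exact ⟨⟨e, (system hk σ).free_of_head he hne.symm⟩, he⟩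

include hk in
/-- The vectors `δ(e)` of the edges that are left out do not lie in the cone. A potential whose
differential is one at one other edge of the same corner or roof, and zero at all other generators
of the cone, is negative at the edge that is left out. -/
lemma delta_dropped_not_mem_cone (a : Idx k) : delta k (σ.dropped a) ∉ σ.cone := by
  rintro ⟨c, hc, hsum⟩
  obtain ⟨o, ho⟩ := exists_free_head hk σ a
  obtain ⟨u, hu⟩ := exists_potential hk σ (Pi.single o 1)
  set X : Edge k → ℝ := fun e => potential u e.1.2 - potential u e.1.1
  have hX : ∀ a, _ := sum_potential_head hk σ u
  have hfree : ∀ e (he : ∀ b, (system hk σ).pivot b ≠ e), e ≠ o.1 → X e = 0 := by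
    intro e he hne
    rw [show X e = _ from hu ⟨e, he⟩, Pi.single_eq_of_ne]
    exact fun h => hne (congrArg Subtype.val h)
  have hrank : ∀ e, (system hk σ).rank a + 1 ≤ (system hk σ).rank ((system hk σ).head e) →
      X e = 0 := by
    refine (system hk σ).eq_zero_of_homogeneous X _ (fun b _ => hX b) fun e he hr => ?_
    refine hfree e he ?_
    rintro rfl
    rw [ho] at hr
    omega
  have h1 : X (σ.dropped a) = -1 := by
    have h2 := hX a
    rw [(system hk σ).sum_head_eq, Finset.sum_eq_zero (s := Finset.univ.filter fun e =>
      (system hk σ).tail e = some a), Finset.sum_eq_single o.1] at h2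
    · have h3 : X o.1 = 1 := by
        rw [show X o.1 = _ from hu o, Pi.single_eq_same]
      have h4 : X (σ.dropped a) + X o.1 = 0 := h2
      linarith
    · intro e he hne
      simp only [Finset.mem_filter, Finset.mem_univ, true_and] at he
      exact hfree e ((system hk σ).free_of_head he.1 he.2) hne
    · intro hn
      exact absurd (by simpa using ⟨ho, o.2 a⟩) hn
    · intro e he
      exact hrank e ((system hk σ).rank_lt e a (by simpa using he))
  have h5 : X (σ.dropped a) = ∑ g : (system hk σ).Free, c g * X g.1 := by
    simp only [X, ← sum_mul_delta]
    rw [hsum]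
    simp only [Finset.sum_apply, Pi.smul_apply, smul_eq_mul, Finset.mul_sum]
    rw [Finset.sum_comm]
    refine Finset.sum_congr rfl fun g _ => Finset.sum_congr rfl fun d _ => ?_
    ring
  have h6 : 0 ≤ ∑ g : (system hk σ).Free, c g * X g.1 := by
    refine Finset.sum_nonneg fun g _ => mul_nonneg (hc g) ?_
    rw [show X g.1 = _ from hu g, Pi.single_apply]
    split_ifs <;> norm_num
  linarith

lemma delta_mem_cone (g : σ.Gen) : delta k g.1 ∈ σ.cone :=
  ⟨Pi.single g 1, fun g' => by rw [Pi.single_apply]; split_ifs <;> norm_num, by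
    rw [Finset.sum_eq_single g] <;> simp +contextual⟩

include hk in
lemma delta_mem_cone_iff (e : Edge k) : delta k e ∈ σ.cone ↔ ∀ a, σ.dropped a ≠ e := by
  refine ⟨?_, fun h => delta_mem_cone σ ⟨e, h⟩⟩
  rintro h a rfl
  exact delta_dropped_not_mem_cone hk σ a h

/-! ### The dual graph -/

/-- The side of a unit square that crosses an edge of the graph. -/
def dualEdge (e : Edge k) : (ℕ × ℕ) × (ℕ × ℕ) :=
  ((e.1.2.1, e.1.1.2), (e.1.1.1 + 1, e.1.2.2 + 1))

lemma crosses_dualEdge (hk : ∀ j, 0 < k j) (e : Edge k) : Crosses k (dualEdge e) e := by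
  obtain ⟨x, y, ⟨h, h'⟩ | ⟨h, h'⟩⟩ := edge_cases hk e <;>
    simp only [Crosses, dualEdge, h, Prod.mk_add_mk, Prod.mk.injEq] <;> omega

lemma eq_of_crosses (hk : ∀ j, 0 < k j) {w : (ℕ × ℕ) × (ℕ × ℕ)} {e e' : Edge k}
    (h : Crosses k w e) (h' : Crosses k w e') : e = e' := by
  have h2 := h.symm.trans h'
  refine Subtype.ext ?_
  obtain ⟨x, y, ⟨h1, -⟩ | ⟨h1, -⟩⟩ := edge_cases hk e <;>
    obtain ⟨x', y', ⟨h1', -⟩ | ⟨h1', -⟩⟩ := edge_cases hk e' <;>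
    simp only [h1, h1', Prod.mk_add_mk, Prod.mk.injEq] at h2 ⊢ <;> omega

lemma dualEdge_mem (hk : ∀ j, 0 < k j) (e : Edge k) : dualEdge e ∈ dualEdges k := by
  refine Finset.mem_filter.2 ⟨?_, e, crosses_dualEdge hk e⟩
  refine Finset.mem_biUnion.2 ⟨base e, base_mem_dots hk e, ?_⟩
  obtain ⟨x, y, ⟨h, h'⟩ | ⟨h, h'⟩⟩ := edge_cases hk e <;> simp [base, dualEdge, h]

lemma dualEdge_eq_of_crosses (hk : ∀ j, 0 < k j) {w : (ℕ × ℕ) × (ℕ × ℕ)}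
    (hw : w ∈ ladderEdges k) {e : Edge k} (h : Crosses k w e) : dualEdge e = w := by
  simp only [ladderEdges, Finset.mem_biUnion, Finset.mem_insert, Finset.mem_singleton] at hw
  obtain ⟨⟨a, b⟩, -, hw⟩ := hw
  simp only [Crosses] at h
  obtain ⟨x, y, ⟨h1, -⟩ | ⟨h1, -⟩⟩ := edge_cases hk e <;> rcases hw with rfl | rfl | rfl | rfl <;>
    simp only [dualEdge, h1, Prod.mk_add_mk, Prod.mk.injEq] at h ⊢ <;> omega

lemma prod_dualEdges (hk : ∀ j, 0 < k j) {A : Type*} [CommMonoid A]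
    (f : (ℕ × ℕ) × (ℕ × ℕ) → A) : ∏ w ∈ dualEdges k, f w = ∏ e : Edge k, f (dualEdge e) := by
  refine (Finset.prod_bij (fun e _ => dualEdge e) (fun e _ => dualEdge_mem hk e) ?_ ?_
    fun _ _ => rfl).symm
  · intro e _ e' _ h
    exact eq_of_crosses hk (crosses_dualEdge hk e) (h ▸ crosses_dualEdge hk e')
  · intro w hw
    obtain ⟨h1, e, he⟩ := Finset.mem_filter.1 hw
    exact ⟨e, Finset.mem_univ _, dualEdge_eq_of_crosses hk h1 he⟩

lemma boxAt_eq_some (p : ℕ × ℕ) (b : Box k) : boxAt k p = some b ↔ b.1 + (1, 1) = p := by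
  unfold boxAt
  split_ifs with h
  · rw [Option.some.injEq]
    refine ⟨fun h1 => h1 ▸ h.choose_spec, fun h1 => Subtype.ext ?_⟩
    exact add_right_cancel (h.choose_spec.trans h1.symm)
  · simp only [false_iff]
    exact fun h1 => h ⟨b, h1⟩

lemma dualHead_dualEdge (hk : ∀ j, 0 < k j) (e : Edge k) :
    dualHead k (dualEdge e) = some (edgeHead hk e) := by
  have hw : (dualEdge e).2 = base e + (1, 1) := rfl
  unfold dualHead
  rcases hb : boxAt k (dualEdge e).2 with _ | b
  · rcases ha : edgeHead hk e with i | b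
    · have h : ∃ i : Fin l, ∃ e' ∈ roof k i, Crosses k (dualEdge e) e' :=
        ⟨i, e, (edgeHead_eq_inl hk e i).1 ha, crosses_dualEdge hk e⟩
      obtain ⟨e', he', hc⟩ := h.choose_spec
      rw [← eq_of_crosses hk (crosses_dualEdge hk e) hc, ← edgeHead_eq_inl hk, ha] at he'
      simp only [dif_pos h]
      exact congrArg some he'.symm
    · rw [edgeHead, cell_eq_inr] at ha
      have := (boxAt_eq_some (dualEdge e).2 b).2 (by rw [hw, ← ha])
      rw [hb] at this
      cases this
  · rw [boxAt_eq_some, hw] at hb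
    rw [(show edgeHead hk e = .inr b by
      rw [edgeHead, cell_eq_inr]
      exact (add_right_cancel hb).symm)]

lemma dualTail_dualEdge (hk : ∀ j, 0 < k j) (e : Edge k) :
    dualTail k (dualEdge e) = edgeTail e := by
  have h : ∀ b, boxAt k (dualEdge e).1 = some b ↔ e ∈ oppCorner k b := by
    intro b
    rw [boxAt_eq_some]
    obtain ⟨⟨a, c⟩, hb⟩ := b
    obtain ⟨x, y, ⟨h, h'⟩ | ⟨h, h'⟩⟩ := edge_cases hk e <;>
      simp only [dualEdge, oppCorner, Finset.mem_filter, Finset.mem_univ, true_and, h,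
        Prod.mk.injEq, Prod.mk_add_mk, add_zero] <;> omega
  refine Option.ext fun a => ?_
  simp only [dualTail, Option.map_eq_some_iff, h]
  obtain i | b := a
  · simp [edgeTail_ne_inl]
  · simp [edgeTail_eq_inr]

/-! ### The coefficients -/

lemma extend_dualHead (hk : ∀ j, 0 < k j) (σ : MaxCone k) (m : Idx k → ℕ) (e : Edge k) :
    extend m (dualHead k (dualEdge e)) = m ((system hk σ).head e) := by
  rw [dualHead_dualEdge hk, extend, system_head, Option.elim_some]

lemma extend_dualTail (hk : ∀ j, 0 < k j) (σ : MaxCone k) (m : Idx k → ℕ) (e : Edge k) :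
    extend m (dualTail k (dualEdge e)) = ((system hk σ).tail e).elim 0 m := by
  rw [dualTail_dualEdge hk, extend, system_tail]

variable {A : Type*} [CommMonoid A]

lemma prod_comp_head (hk : ∀ j, 0 < k j) (σ : MaxCone k) (f : Idx k → A) :
    ∏ e, f ((system hk σ).head e) = (∏ i : Fin l, f (.inl i) ^ (k i.castSucc + k i.succ)) *
      ∏ b : Box k, f (.inr b) ^ 2 := by
  rw [← Finset.prod_fiberwise' _ (system hk σ).head f, Fintype.prod_sum_type]
  simp only [Finset.prod_const, filter_head_inl, filter_head_inr, card_roof hk, card_corner hk,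
    roofLength_eq]

lemma prod_comp_tail (hk : ∀ j, 0 < k j) (σ : MaxCone k) (f : Option (Idx k) → A)
    (hf : f none = 1) :
    ∏ e, f ((system hk σ).tail e) = ∏ b : Box k, f (some (.inr b)) ^ 2 := by
  rw [← Finset.prod_fiberwise' _ (system hk σ).tail f, Fintype.prod_option, Fintype.prod_sum_type]
  simp only [Finset.prod_const, filter_tail_inl, filter_tail_inr, card_oppCorner hk, hf, one_pow,
    Finset.card_empty, pow_zero, one_mul]

/-- The factorials in the binomial coefficients cancel, since every exponent of a box is the head
of two edges of the dual graph and the tail of two. -/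
lemma coeffA_eq (hk : ∀ j, 0 < k j) (σ : MaxCone k) (m : Idx k → ℕ) :
    coeffA k m = (system hk σ).coeff m := by
  have hhead := prod_comp_head hk σ fun a => ((m a)! : ℂ)
  have htail := prod_comp_tail hk σ (fun v => ((v.elim 0 m)! : ℂ)) (by simp)
  have hchoose : ∏ w ∈ dualEdges k,
      ((extend m (dualHead k w)).choose (extend m (dualTail k w)) : ℂ) =
      ∏ e, ((m ((system hk σ).head e)).choose (((system hk σ).tail e).elim 0 m) : ℂ) := by
    rw [prod_dualEdges hk]
    refine Finset.prod_congr rfl fun e _ => ?_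
    rw [extend_dualHead hk σ, extend_dualTail hk σ]
  rw [coeffA, hchoose, TriangularSystem.coeff]
  split_ifs with h
  · rw [Finset.prod_congr rfl fun e _ => Nat.cast_choose ℂ (h e), Finset.prod_div_distrib,
      Finset.prod_mul_distrib, hhead, htail, Finset.prod_inv_distrib, Finset.prod_inv_distrib]
    have h1 : ∏ i : Fin l, ((m (.inl i))! : ℂ) ^ (k i.castSucc + k i.succ) ≠ 0 :=
      Finset.prod_ne_zero_iff.2 fun i _ =>
        pow_ne_zero _ (Nat.cast_ne_zero.2 (Nat.factorial_ne_zero _))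
    have h2 : ∏ b : Box k, ((m (.inr b))! : ℂ) ^ 2 ≠ 0 :=
      Finset.prod_ne_zero_iff.2 fun i _ =>
        pow_ne_zero _ (Nat.cast_ne_zero.2 (Nat.factorial_ne_zero _))
    generalize ∏ e, (((m ((system hk σ).head e) - ((system hk σ).tail e).elim 0 m)! : ℕ) : ℂ) = D
    simp only [Option.elim_some]
    generalize ∏ b : Box k, ((m (.inr b))! : ℂ) ^ 2 = R at h2 ⊢
    generalize ∏ i : Fin l, ((m (.inl i))! : ℂ) ^ (k i.castSucc + k i.succ) = P at h1 ⊢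
    rw [mul_comm R, mul_div_mul_right _ _ h2, div_eq_mul_inv, inv_mul_cancel_left₀ h1]
  · push Not at h
    obtain ⟨e, he⟩ := h
    rw [Finset.prod_eq_zero (Finset.mem_univ e), mul_zero]
    rw [Nat.choose_eq_zero_of_lt he, Nat.cast_zero]

/-! ### The angle parametrization, the residue and the period -/

section

variable (hk : ∀ j, 0 < k j) (σ : MaxCone k) {q : Fin l → ℂ} {qt : Box k → ℂ}
  (hq : ∀ i, q i ≠ 0) (hqt : ∀ b, qt b ≠ 0)

lemma parameters_ne_zero (hq : ∀ i, q i ≠ 0) (hqt : ∀ b, qt b ≠ 0) (a : Idx k) :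
    Sum.elim q qt a ≠ 0 := by
  obtain i | b := a
  · exact hq i
  · exact hqt b

lemma mem_mirrorVariety (y : Edge k → ℂ) : y ∈ mirrorVariety k q qt ↔
    ∀ a, (system hk σ).eqn (Sum.elim q qt) a y = 0 := by
  simp only [mirrorVariety, Set.mem_ofPred_eq, eqn_eq hk σ]

variable {σ} {κ : Edge k → ℂ} {L : Edge k → (system hk σ).Free → ℤ}
  (h : (system hk σ).IsMonomialSolution (Sum.elim q qt) κ L)

include h in
lemma isAngleParam_angleParam :
    σ.IsAngleParam q qt (TriangularSystem.angleParam (S := system hk σ) κ L) := fun θ =>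
  ⟨(mem_mirrorVariety hk σ _).2 (h.eqn_angleParam θ), h.angleParam_free θ⟩

include hk hq hqt in
lemma isAngleParam_unique {s t : (σ.Gen → ℝ) → Edge k → ℂ} (hs : σ.IsAngleParam q qt s)
    (ht : σ.IsAngleParam q qt t) : s = t := by
  funext θ
  refine TriangularSystem.eq_of_eqn (parameters_ne_zero hq hqt)
    ((mem_mirrorVariety hk σ _).1 (hs θ).1) ((mem_mirrorVariety hk σ _).1 (ht θ).1) fun g => ?_
  rw [(hs θ).2 g, (ht θ).2 g]

include hk hq hqt in
lemma bijOn_angles {s : (σ.Gen → ℝ) → Edge k → ℂ} (hs : σ.IsAngleParam q qt s) :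
    Set.BijOn s σ.angles (σ.cycle q qt) := by
  refine ⟨fun θ _ => ⟨(hs θ).1, fun e he => ?_⟩, fun θ hθ θ' hθ' heq => ?_, fun y hy => ?_⟩
  · rw [(hs θ).2 ⟨e, (delta_mem_cone_iff hk σ e).1 he⟩, Complex.norm_exp_ofReal_mul_I]
  · funext g
    have h1 := congrFun heq g.1
    rw [(hs θ).2, (hs θ').2, Complex.exp_eq_exp_iff_exists_int] at h1
    obtain ⟨n, hn⟩ := h1
    have h2 : θ g = θ' g + n * (2 * Real.pi) := by
      have : (θ g : ℂ) * Complex.I = ((θ' g + n * (2 * Real.pi) : ℝ) : ℂ) * Complex.I := by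
        rw [hn]
        push_cast
        ring
      exact_mod_cast mul_right_cancel₀ Complex.I_ne_zero this
    have h3 := hθ g (Set.mem_univ _)
    have h4 := hθ' g (Set.mem_univ _)
    have hpi := Real.two_pi_pos
    have h5 : n = 0 := by
      have h6 : (n : ℝ) < 1 := by
        by_contra hcon
        push Not at hcon
        nlinarith [h3.2, h4.1]
      have h7 : (-1 : ℝ) < n := by
        by_contra hcon
        push Not at hcon
        nlinarith [h3.1, h4.2]
      have h8 : n < 1 := by exact_mod_cast h6
      have h9 : -1 < n := by exact_mod_cast h7
      omega
    simpa [h5] using h2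
  · let θ : σ.Gen → ℝ := fun g => toIcoMod Real.two_pi_pos 0 (y g.1).arg
    refine ⟨θ, fun g _ => ?_, ?_⟩
    · have := toIcoMod_mem_Ico Real.two_pi_pos 0 (y g.1).arg
      rwa [zero_add] at this
    · refine TriangularSystem.eq_of_eqn (parameters_ne_zero hq hqt)
        ((mem_mirrorVariety hk σ _).1 (hs θ).1) ((mem_mirrorVariety hk σ _).1 hy.1) fun g => ?_
      rw [(hs θ).2 g]
      have h1 : ‖y g.1‖ = 1 := hy.2 _ (delta_mem_cone σ g)
      conv_rhs => rw [← Complex.norm_mul_exp_arg_mul_I (y g.1), h1]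
      rw [Complex.ofReal_one, one_mul, Complex.exp_eq_exp_iff_exists_int]
      refine ⟨-toIcoDiv Real.two_pi_pos 0 (y g.1).arg, ?_⟩
      simp only [θ, toIcoMod, zsmul_eq_mul]
      push_cast
      ring

lemma isResidue_iff (η : (Edge k → ℂ) → (Edge k → ℂ) [⋀^σ.Gen]→ₗ[ℂ] ℂ) :
    σ.IsResidue q qt η ↔ (system hk σ).IsResidue (Sum.elim q qt) η := by
  have he : eqn k q qt = (system hk σ).eqn (Sum.elim q qt) := funext (eqn_eq hk σ q qt)
  unfold MaxCone.IsResidue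
  rw [mirrorVariety, he]
  rfl

include hk hq hqt in
lemma exists_isResidue : ∃ η, σ.IsResidue q qt η := by
  obtain ⟨η, hη⟩ := TriangularSystem.exists_isResidue (S := system hk σ)
    (parameters_ne_zero hq hqt)
  exact ⟨η, (isResidue_iff hk η).2 hη⟩

include hk hq hqt in
/-- The monomial solution provides the angle parametrization, along which the residue is constant. -/
lemma exists_angleParam : ∃ s : (σ.Gen → ℝ) → Edge k → ℂ, σ.IsAngleParam q qt s ∧ ContDiff ℝ ∞ s ∧
    (∀ η, σ.IsResidue q qt η → σ.integrand s η = fun θ =>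
      Complex.exp (∑ e, s θ e) * Complex.I ^ (dots k).card) ∧
    HasSum (fun m : Idx k → ℕ => coeffA k m * ((∏ i, q i ^ m (.inl i)) * ∏ b, qt b ^ m (.inr b)))
      (((2 * Real.pi : ℂ) ^ (dots k).card)⁻¹ * ∫ θ in σ.angles, Complex.exp (∑ e, s θ e)) := by
  obtain ⟨κ, L, h⟩ := (system hk σ).exists_isMonomialSolution (Sum.elim q qt)
    (parameters_ne_zero hq hqt)
  have hsum : ∀ m : Idx k → ℕ, (system hk σ).coeff m * ∏ a, Sum.elim q qt a ^ m a =
      coeffA k m * ((∏ i, q i ^ m (.inl i)) * ∏ b, qt b ^ m (.inr b)) := by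
    intro m
    rw [coeffA_eq hk σ, Fintype.prod_sum_type]
    rfl
  refine ⟨_, isAngleParam_angleParam hk h, TriangularSystem.contDiff_angleParam κ L,
    fun η hη => funext fun θ => ?_, ?_⟩
  · have h1 := h.residue_angleParam (parameters_ne_zero hq hqt) ((isResidue_iff hk η).1 hη) θ
    rw [card_free] at h1
    exact congrArg (_ * ·) h1
  · have h1 := h.hasSum_integral
    rw [card_free] at h1
    simp only [hsum] at h1
    exact h1

end

end PartialFlag

theorem mainTheorem10 (l : ℕ) (k : Fin (l + 1) → ℕ) (hk : ∀ j, 0 < k j)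
    (σ : PartialFlag.MaxCone k) (q : Fin l → ℂ) (qt : PartialFlag.Box k → ℂ)
    (hq : ∀ i, q i ≠ 0) (hqt : ∀ b, qt b ≠ 0) :
    (∃! s, σ.IsAngleParam q qt s) ∧ (∃ η, σ.IsResidue q qt η) ∧
    ∀ s η, σ.IsAngleParam q qt s → σ.IsResidue q qt η →
      ContDiff ℝ ∞ s ∧ Set.BijOn s σ.angles (σ.cycle q qt) ∧
      IntegrableOn (σ.integrand s η) σ.angles ∧
      HasSum (fun m : PartialFlag.Idx k → ℕ =>
        PartialFlag.coeffA k m *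
          ((∏ i, q i ^ m (.inl i)) * ∏ b, qt b ^ m (.inr b)))
        (σ.period s η) := by
  obtain ⟨s₀, hs₀, hsmooth, hint, hsum⟩ := PartialFlag.exists_angleParam (σ := σ) hk hq hqt
  refine ⟨⟨s₀, hs₀, fun t ht => PartialFlag.isAngleParam_unique hk hq hqt ht hs₀⟩,
    PartialFlag.exists_isResidue hk hq hqt, fun s η hs hη => ?_⟩
  obtain rfl := PartialFlag.isAngleParam_unique hk hq hqt hs hs₀
  refine ⟨hsmooth, PartialFlag.bijOn_angles hk hq hqt hs, ?_, ?_⟩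
  · have hc : Continuous fun θ => Complex.exp (∑ e, s θ e) *
        Complex.I ^ (PartialFlag.dots k).card := by
      have := hsmooth.continuous
      fun_prop
    rw [hint η hη]
    refine (hc.continuousOn.integrableOn_compact
      (isCompact_univ_pi fun _ => isCompact_Icc (a := (0 : ℝ)) (b := 2 * Real.pi))).mono_set ?_
    exact Set.pi_mono fun _ _ => Set.Ico_subset_Icc_self
  · -- The factors `√-1 ^ |D|` of the residue and of the normalization cancel.
    have hI : Complex.I ^ (PartialFlag.dots k).card ≠ 0 := pow_ne_zero _ Complex.I_ne_zero
    rw [PartialFlag.MaxCone.period, hint η hη, integral_mul_const, mul_pow, mul_inv,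
      mul_comm (∫ _ in _, _), ← mul_assoc, inv_mul_cancel_right₀ hI]
    exact hsum
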